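/- **Setting.** Consider a Turing machine with states $Q_1,\dots,Q_N$ ($N\ge 1$), tape symbols $0,1$, a tape with cells $1,2,3,\dots$ (infinite to the right only), initial state $Q_1$, and unique halt state $Q_N$, from which there is no transition. For every $i<N$ and $b\in\{0,1\}$ a transition $d(Q_i,b)=(Q_j,b',D)$ with $D\in\{L,R\}$ is given (the head moves in every step; moving left from cell $1$ is a crash, and the computation then has no further step). On input $w=w_1\cdots w_k\in\{0,1\}^*$ the machine starts in state $Q_1$, scanning cell $1$, with $w_1,\dots,w_k$ in the cells $1,\dots,k$ and $0$ in all other cells. **Turing Tumble.** A board is an unlimited grid (unbounded to the left, to the right and downwards) with at most one part at each site. One ball at a time rolls downwards, from each part to the site at the lower left or lower right. A *ramp* sends it to a fixed side; a *crossover* or a *trigger* lets it continue in its direction of motion (left or right); a trigger moreover releases a new ball from its hopper, which starts after the present ball has been intercepted; an *interceptor* catches the ball; a *gear bit* showing $0$ (showing $1$) is flipped and sends the ball to the lower right (lower left). Flipping a gear bit flips all gear bits that are connected with it through a chain of horizontally or vertically adjacent gears and gear bits. Infinitely many parts, and infinitely many triggers for each hopper, are allowed. Three linked gear bits, of which the ball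 passes two, give a nondestructive read that branches on the value; replacing one of the lower two by a ramp gives Write-0 and Write-1 (with or without branching on the old value); a nondestructive read without branching is called Ignore, and is used wherever a line of ramps crosses a gear chain without acting on it. **The board simulating the machine.** There are three hoppers, for $0$-, $1$- and Q-balls, with triggers $T0$, $T1$, $TQ$. * *State transition module.* Below each of the $0$- and the $1$-hopper there is a read-branch-write tree: rows of gear bits $Q_1,\dots,Q_N$ downwards, in which a ball branches into column $i$ upon finding $Q_i=1$; it is intercepted immediately below $Q_N$ if $i=N$. If $i<N$, in the tree below the $b$-hopper with $d(Q_i,b)=(Q_j,b',D)$, column $i$ passes rows $Q_N',\dots,Q_1'$, at which it writes $1$ to $Q_j'$ and $0$ to all other $Q_l'$. The rows of $Q_l$ and $Q_l'$ span both trees and are linked by nested C-shaped gear chains, so that they always show the same value. * *Router.* The column is then routed to the line $Db'$ among four lines $L0,L1,R0,R1$. These run down the board without end, together with a line $Q$ coming from the Q-hopper (the bus). * *Tape.* Along the bus there are 3-cells number $1,2,3,\dots$, each with a row of linked gear bits for $h$, then one for $S$, then one for $p$. For $x\ge2$, the row $p$ of the 3-cell $x$ is linked with the row $h$ of the 3-cell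 $x-1$ by gear chains running alternately on the right and on the left side. At a row $h$, the lines $L0,L1,R0,R1$ pass a Write-0 and the line $Q$ a nondestructive read; if $h$ was $0$ the ball stays on the bus, and if $h$ was $1$ it branches off into this 3-cell, onto a line $L0',L1',R0',R1'$ or $Q'$. The line $Q'$ reads $S$ nondestructively, triggers $T0$ or $T1$ according to the value, and ends in an interceptor. The lines $L0',R0'$ write $0$ to $S$ and $L1',R1'$ write $1$ to $S$. Then $L0',L1'$ write $1$ to $p$, trigger $TQ$ and end in an interceptor, whereas $R0',R1'$ write $0$ to $p$, go on to the next 3-cell, write $1$ to its $h$, trigger $TQ$ and end in an interceptor. Initially $Q_1=1$ and all other $Q_i$ are $0$; $h=1$ in the first 3-cell and $h=0$ in all others; $S=w_x$ in the 3-cell $x$ for $x\le k$ and $S=0$ in all others. A trigger $TQ$ is pressed once. **Theorem.** For an explicit layout of this board on the grid the following holds, for every such machine, every input $w$ and every $n\ge0$. If the machine makes (at least) $n$ steps on input $w$, then the board releases and intercepts at least $2n$ balls, and at the moment when the $2n$-th ball has just been intercepted (for $n=0$: at the start) all gear bits that represent the same variable show the same value, and (a) exactly one of $Q_1,\dots,Q_N$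 is set to $1$, namely the state of the machine after $n$ steps; (b) exactly one 3-cell has $h=1$, namely the one whose number is that of the cell scanned by the machine after $n$ steps; (c) for every $x$, the value of $S$ in the 3-cell $x$ is the content of tape cell $x$ after $n$ steps. -/

import Mathlib

namespace TuringTumble

/-! ### The Turing machines that are simulated -/

/-- Left or right: a direction of motion of the head, of a ramp, or of a rolling ball. -/
inductive Side where
  | left
  | right
  deriving DecidableEq

/-- A Turing machine with the `m + 1` states `0, …, m` and tape symbols `0 = false`, `1 = true`.
State `0` is initial; state `m` is the unique halt state and has no transitions.  In each other
state (an element of `Fin m`) a transition (new state, written symbol, motion) is given for both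
symbols, and it always moves the head. -/
structure Machine (m : ℕ) where
  δ : Fin m → Bool → Fin (m + 1) × Bool × Side

/-- A configuration; the tape is infinite to the right only, its leftmost cell is cell `0`. -/
structure Config (m : ℕ) where
  state : Fin (m + 1)
  head : ℕ
  tape : ℕ → Bool

/-- Input `w`: the word stands at the left end of the tape, all other cells hold `0`, and the head
scans the leftmost cell. -/
def Config.initial (m : ℕ) (w : List Bool) : Config m where
  state := 0
  head := 0
  tape := fun i => w.getD i false

/-- One step; there is none from the halt state, and moving left from the leftmost cell crashes. -/
def Machine.step {m : ℕ} (M : Machine m) (c : Config m) : Option (Config m) :=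
  if hq : c.state.val < m then
    let a := M.δ ⟨c.state.val, hq⟩ (c.tape c.head)
    let tape' := Function.update c.tape c.head a.2.1
    match a.2.2, c.head with
    | .right, x => some ⟨a.1, x + 1, tape'⟩
    | .left, x + 1 => some ⟨a.1, x, tape'⟩
    | .left, 0 => none
  else none

/-- The configuration after `n` steps on input `w`, if the machine makes `n` steps. -/
def Machine.after {m : ℕ} (M : Machine m) (w : List Bool) : ℕ → Option (Config m)
  | 0 => some (Config.initial m w)
  | n + 1 => (M.after w n).bind M.step

/-! ### Turing Tumble: pieces, boards, and how balls run -/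

/-- The three ball hoppers (equivalently, the three ball colours): `0`, `1` and `Query`. -/
inductive Hopper where
  | zero
  | one
  | query
  deriving DecidableEq

/-- The parts. `ramp s` sends every ball down and to the side `s`. -/
inductive Piece where
  | ramp (s : Side)
  | crossover
  | interceptor
  | bit
  | gearBit
  | gear
  | trigger (h : Hopper)
  deriving DecidableEq

/-- A site of the board: horizontal coordinate, and depth counted downwards from the top. -/
abbrev Site := ℤ × ℕ

/-- A board, unbounded to the left, to the right and downwards: the part mounted at each site, and
the site onto which each hopper drops its balls. A hopper may be paired with any number of
triggers. -/
structure Board where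
  piece : Site → Option Piece
  drop : Hopper → Site

/-- Parts with teeth: gears and gear bits. -/
def Board.Toothed (B : Board) (p : Site) : Prop :=
  B.piece p = some .gear ∨ B.piece p = some .gearBit

/-- Two toothed parts mesh when they are next to each other, horizontally or vertically. -/
def Board.Meshed (B : Board) (p q : Site) : Prop :=
  B.Toothed p ∧ B.Toothed q ∧
    ((p.2 = q.2 ∧ (p.1 + 1 = q.1 ∨ q.1 + 1 = p.1)) ∨
      (p.1 = q.1 ∧ (p.2 + 1 = q.2 ∨ q.2 + 1 = p.2)))

/-- Connected by a chain of meshing toothed parts. -/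
def Board.Linked (B : Board) : Site → Site → Prop :=
  Relation.ReflTransGen B.Meshed

/-- The side of the site diagonally below `p`. -/
def Site.below (p : Site) : Side → Site
  | .left => (p.1 - 1, p.2 + 1)
  | .right => (p.1 + 1, p.2 + 1)

/-- `values p` is the value shown by the (gear) bit at `p`: pointing left is `0 = false`, pointing
right is `1 = true`. `ball` is the site of the rolling ball, if any, together with the side it is
moving to. `pending` are the balls that were triggered and not yet dropped, and `caught` is the
number of balls intercepted so far. -/
structure State where
  values : Site → Bool
  ball : Option (Site × Side)
  pending : List Hopper
  caught : ℕ

open Classical in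
/-- Flipping the gear bit at `p` flips all gear bits that are linked with it (itself included). -/
noncomputable def Board.turn (B : Board) (p : Site) (σ : Site → Bool) : Site → Bool :=
  fun q => if B.piece q = some .gearBit ∧ B.Linked p q then !σ q else σ q

/-- A bit showing `0` sends the ball to the right, a bit showing `1` sends it to the left. -/
def exitSide : Bool → Side
  | false => .right
  | true => .left

/-- One tick. If no ball is rolling, the next triggered ball is dropped. A rolling ball acts on
the part at its site and moves on. A trigger lets the ball pass in the direction in which it moves;
the ball it releases starts after the ball that is on the board has been intercepted.
A ball that meets no part (or only a plain gear) falls straight down. -/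
noncomputable def Board.tick (B : Board) (s : State) : State :=
  match s.ball with
  | none =>
    match s.pending with
    | [] => s
    | h :: rest => { s with ball := some (B.drop h, .left), pending := rest }
  | some (p, d) =>
    match B.piece p with
    | none => { s with ball := some ((p.1, p.2 + 1), d) }
    | some .gear => { s with ball := some ((p.1, p.2 + 1), d) }
    | some (.ramp e) => { s with ball := some (Site.below p e, e) }
    | some .crossover => { s with ball := some (Site.below p d, d) }
    | some .interceptor => { s with ball := none, caught := s.caught + 1 }
    | some .bit =>
      { s with
        values := Function.update s.values p (!s.values p)
        ball := some (Site.below p (exitSide (s.values p)), exitSide (s.values p)) }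
    | some .gearBit =>
      { s with
        values := B.turn p s.values
        ball := some (Site.below p (exitSide (s.values p)), exitSide (s.values p)) }
    | some (.trigger h) =>
      { s with ball := some (Site.below p d, d), pending := s.pending ++ [h] }

/-- The state after `t` ticks, when the bits initially show `σ` and somebody presses a trigger of
hopper `h` once. -/
noncomputable def Board.run (B : Board) (σ : Site → Bool) (h : Hopper) (t : ℕ) : State :=
  B.tick^[t] { values := σ, ball := none, pending := [h], caught := 0 }

/-! ### Components

The board is composed of `4 × 4` blocks. A ball coming down a line enters a block at the third site
of the top row; leaving downwards it enters the block below in the same way. A ball leaving a block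
*diagonally* rolls from its bottom right site to the top left site of the block at the lower right,
and then joins there the third site of the third row. A gear row runs through the top row of a
block, a gear column through the third column. -/

inductive Block where
  | blank
  | pass
  | merge
  | diagonal
  | cross
  | gearRow
  | gearCol
  | bendSE
  | bendSW
  | bendNE
  | bendNW
  | ignore
  | write (b : Bool)
  | readBranch
  | writeBranch
  | treeRead
  | haltCatch
  | query
  | net
  | fire
  deriving DecidableEq

namespace Picture

abbrev o : Option Piece := none
abbrev L : Option Piece := some (.ramp .left)
abbrev R : Option Piece := some (.ramp .right)
abbrev X : Option Piece := some .crossover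
abbrev I : Option Piece := some .interceptor
abbrev B : Option Piece := some .gearBit
abbrev G : Option Piece := some .gear
abbrev T0 : Option Piece := some (.trigger .zero)
abbrev T1 : Option Piece := some (.trigger .one)
abbrev TQ : Option Piece := some (.trigger .query)

end Picture

open Picture in
/-- The pictures of the blocks: row `0` is the top row. -/
def Block.picture : Block → Matrix (Fin 4) (Fin 4) (Option Piece)
  | .blank => -- nothing
    !![o, o, o, o;
       o, o, o, o;
       o, o, o, o;
       o, o, o, o]
  | .pass => -- a line running down
    !![o, o, R, o;
       o, o, o, L;
       o, o, R, o;
       o, o, o, L]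
  | .merge => -- a line running down, joined by a diagonal line from the upper left
    !![R, o, R, o;
       o, R, o, L;
       o, o, R, o;
       o, o, o, L]
  | .diagonal => -- a diagonal line, joined by a line from above
    !![R, o, R, o;
       o, R, o, L;
       o, o, R, o;
       o, o, o, R]
  | .cross => -- a line running down and a diagonal line cross
    !![R, o, R, o;
       o, R, o, L;
       o, o, X, o;
       o, R, o, R]
  | .gearRow =>
    !![G, G, G, G;
       o, o, o, o;
       o, o, o, o;
       o, o, o, o]
  | .gearCol =>
    !![o, o, G, o;
       o, o, G, o;
       o, o, G, o;
       o, o, G, o]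
  | .bendSE => -- a gear chain from the right turns down
    !![o, o, G, G;
       o, o, G, o;
       o, o, G, o;
       o, o, G, o]
  | .bendSW => -- a gear chain from the left turns down
    !![G, G, G, o;
       o, o, G, o;
       o, o, G, o;
       o, o, G, o]
  | .bendNE => -- a gear chain from the right turns up
    !![o, o, G, G;
       o, o, o, o;
       o, o, o, o;
       o, o, o, o]
  | .bendNW => -- a gear chain from the left turns up
    !![G, G, G, o;
       o, o, o, o;
       o, o, o, o;
       o, o, o, o]
  | .ignore => -- a line crosses a gear row without effect
    !![G, G, B, G;
       o, B, G, B;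
       o, o, R, o;
       o, o, o, L]
  | .write false => -- Write-0 without branching
    !![G, G, B, G;
       o, R, G, B;
       o, o, R, o;
       o, o, o, L]
  | .write true => -- Write-1 without branching
    !![G, G, B, G;
       o, B, G, L;
       o, o, R, o;
       o, o, o, L]
  | .readBranch => -- nondestructive read: down if 0, diagonally to the right if 1
    !![G, G, B, G;
       o, B, G, B;
       o, o, X, o;
       o, R, o, R]
  | .writeBranch => -- Write-0; down if the bit was 0, diagonally to the right if it was 1
    !![G, G, B, G;
       o, R, G, B;
       o, o, X, o;
       o, R, o, R]
  | .treeRead => -- destructive read: down if 1, diagonally to the right if 0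
    !![G, G, B, G;
       o, L, o, L;
       R, o, R, o;
       o, R, o, R]
  | .haltCatch => -- a gear bit with interceptors immediately below
    !![G, G, B, G;
       o, I, o, I;
       o, o, o, o;
       o, o, o, o]
  | .query => -- nondestructive read, releasing a 0-ball if 0 and a 1-ball if 1
    !![G, G, B, G;
       o, B, G, B;
       o, o, X, o;
       o, T0, o, T1]
  | .net => -- the interceptor for a ball coming from `query`
    !![I, o, o, o;
       o, o, o, o;
       o, o, o, o;
       o, o, o, o]
  | .fire => -- release a Q-ball and intercept
    !![o, o, TQ, o;
       o, I, o, I;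
       o, o, o, o;
       o, o, o, o]

/-! ### The board that simulates `M`

Blocks have coordinates `(X, r)` (block column, block row). The finite control occupies the columns
`X < 0`, in the block rows `r < 6 * (m + 1) + 4`. The bus lines `L0, L1, R0, R1, Q` are the columns
`0, 1, 2, 3, 4`, and the lines `L0', L1', R0', R1', Q'` inside the 3-cells are the columns
`5, 6, 7, 8, 9`. -/

/-- What `M` does in state `i` on symbol `b`; nothing for the halt state. -/
def Machine.action {m : ℕ} (M : Machine m) (i : ℕ) (b : Bool) :
    Option (Fin (m + 1) × Bool × Side) :=
  if h : i < m then some (M.δ ⟨i, h⟩ b) else none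

/-- State Transition Module, the tree below the `b`-ball hopper, in its column number `i`
(`i ≤ m`). The rows `0, 2, …, 2 m` are the rows of the state variables `Q 0, …, Q m`: a ball rolls
along column `i` after it found `Q 0, …, Q (i - 1)` to be `0`; if it finds `Q i = 1`, it stays in
this column. The last `m + 1` rows are the rows `Q' m, …, Q' 0`, where the new state is written. -/
def Machine.treeBlock {m : ℕ} (M : Machine m) (b : Bool) (i r : ℕ) : Block :=
  if r < 2 * (m + 1) then
    if r % 2 = 0 then
      if i < r / 2 then .ignore
      else if i = r / 2 then (if i = m then .haltCatch else .treeRead)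
      else .gearRow
    else
      if i ≤ r / 2 ∧ i < m then .pass
      else if i = r / 2 + 1 then .merge
      else .blank
  else
    match M.action i b with
    | none => .gearRow
    | some a => .write (decide (a.1.val = 3 * (m + 1) - 1 - r))

/-- The nested C-shaped gear chains connecting the row of `Q e` with the row of `Q' e`, in the
column used by the chain number `e`. -/
def chainBlock (m e r : ℕ) (top bottom : Block) : Block :=
  if r = 2 * e then top
  else if r = 3 * (m + 1) - 1 - e then bottom
  else if 2 * e < r ∧ r < 3 * (m + 1) - 1 - e then .gearCol
  else if r < 2 * e ∧ r % 2 = 1 then .blank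
  else .gearRow

/-- The State Transition Module: block rows `r < 3 * (m + 1)`, block columns from `-4 * (m + 1)` to
`-1`. From left to right: the gear chains on the left, the tree below the 0-ball hopper, the tree
below the 1-ball hopper, the gear chains on the right. -/
def Machine.stmBlock {m : ℕ} (M : Machine m) (X : ℤ) (r : ℕ) : Block :=
  if X < -4 * (m + 1) then .blank
  else if X < -3 * (m + 1) then chainBlock m (X + 4 * (m + 1)).toNat r .bendSE .bendNE
  else if X < -2 * (m + 1) then M.treeBlock false (X + 3 * (m + 1)).toNat r
  else if X < -(m + 1) then M.treeBlock true (X + 2 * (m + 1)).toNat r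
  else chainBlock m (-1 - X).toNat r .bendSW .bendNW

/-- The action to be carried out by a ball leaving the State Transition Module in column `X`. -/
def Machine.outgoing {m : ℕ} (M : Machine m) (X : ℤ) : Option (Fin (m + 1) × Bool × Side) :=
  if -3 * (m + 1) ≤ X ∧ X < -2 * (m + 1) then M.action (X + 3 * (m + 1)).toNat false
  else if -2 * (m + 1) ≤ X ∧ X < -(m + 1) then M.action (X + 2 * (m + 1)).toNat true
  else none

/-- The bus line `L0`, `L1`, `R0` or `R1` that stands for writing `b` and moving to side `s`. -/
def busLine : Side → Bool → ℤ
  | .left, false => 0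
  | .left, true => 1
  | .right, false => 2
  | .right, true => 3

/-- The Router. From block row `3 * (m + 1)` on, all lines coming from the State Transition Module
run diagonally to the right, until they reach the bus line they belong to; they cross the bus
lines before it. -/
def Machine.routerBlock {m : ℕ} (M : Machine m) (X : ℤ) (r : ℕ) : Block :=
  let plain : Block := if 0 ≤ X ∧ X ≤ 4 then .pass else .blank
  match M.outgoing (X + 3 * (m + 1) - r) with
  | none => plain
  | some a =>
    if X < 0 then .diagonal
    else if X < busLine a.2.2 a.2.1 then .cross
    else if X = busLine a.2.2 a.2.1 then .merge
    else plain

/-- Block row `j` (`0 ≤ j < 10`) of the 3-cell number `k`.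
Row `0` is the row of `h`, row `6` the row of `S`, row `8` the row of `p`. The gear chain of `h`
(of `p`) continues to the column `11` on the right if `k` is even (odd), and to the column `-1` on
the left if `k` is odd (even); in these columns the chain of `p` is connected with the chain of `h`
of the previous 3-cell, if there is one. -/
def cellBlock (k j : ℕ) (X : ℤ) : Block :=
  let even := k % 2 = 0
  if X = -1 then
    if even then
      if j < 8 then (if k = 0 then .blank else .gearCol)
      else if j = 8 then .bendNE
      else .blank
    else
      if j = 0 then .bendSE else .gearCol
  else if X = 11 then
    if even then
      if j = 0 then .bendSW else .gearCol
    else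
      if j < 8 then .gearCol
      else if j = 8 then .bendNW
      else .blank
  else if 0 ≤ X ∧ X ≤ 4 then
    -- the bus
    if j = 0 then (if X = 4 then .readBranch else .writeBranch)
    else if j ≤ 4 ∧ (j : ℤ) ≤ X then .cross
    else if j = 8 ∧ even then .ignore
    else .pass
  else if 5 ≤ X ∧ X ≤ 10 then
    -- inside the 3-cell
    if j = 0 then
      if X = 7 ∨ X = 8 then .write true
      else if X ≤ 6 ∨ even then .gearRow
      else .blank
    else if j = 1 ∧ (X = 7 ∨ X = 8) then .fire
    else if j ≤ 4 then (if X ≤ j + 4 then .diagonal else .blank)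
    else if j = 5 then (if X ≤ 9 then .merge else .blank)
    else if j = 6 then
      if X = 5 ∨ X = 7 then .write false
      else if X = 6 ∨ X = 8 then .write true
      else if X = 9 then .query
      else .blank
    else if j = 7 then (if X ≤ 8 then .pass else .net)
    else if j = 8 then
      if X ≤ 6 then .write true
      else if X ≤ 8 then .write false
      else if even then .blank
      else .gearRow
    else -- `j = 9`
      if X ≤ 6 then .fire
      else if X ≤ 8 then .pass
      else .blank
  else .blank

/-- The block row in which the first 3-cell starts. -/
def tapeRow (m : ℕ) : ℕ := 6 * (m + 1) + 4

/-- All blocks of the board. -/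
def Machine.block {m : ℕ} (M : Machine m) (X : ℤ) (r : ℕ) : Block :=
  if X < 0 ∧ r < 3 * (m + 1) then M.stmBlock X r
  else if r < tapeRow m then M.routerBlock X r
  else cellBlock ((r - tapeRow m) / 10) ((r - tapeRow m) % 10) X

/-- The board simulating `M`. -/
def Machine.board {m : ℕ} (M : Machine m) : Board where
  piece := fun p =>
    (M.block (p.1 / 4) (p.2 / 4)).picture (Fin.ofNat 4 p.2) (Fin.ofNat 4 (p.1 % 4).toNat)
  drop
    | .zero => (4 * (-3 * (m + 1)) + 2, 0)
    | .one => (4 * (-2 * (m + 1)) + 2, 0)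
    | .query => (4 * 4 + 2, 0)

/-! ### The variables shown by the board -/

/-- The variables: the state variables `Q i`, and for every 3-cell `h` and `S`. The variable `p` of
the 3-cell number `k + 1` is the variable `h` of the 3-cell number `k`; that of the first 3-cell is
`pFirst`. -/
inductive Var (m : ℕ) where
  | Q (i : Fin (m + 1))
  | h (k : ℕ)
  | S (k : ℕ)
  | pFirst

/-- `RowVar r v`: the gear bits in block row `r` represent the variable `v`. -/
inductive RowVar (m : ℕ) : ℕ → Var m → Prop where
  | Q (i : Fin (m + 1)) : RowVar m (2 * i) (.Q i)
  | Q' (i : Fin (m + 1)) : RowVar m (3 * (m + 1) - 1 - i) (.Q i)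
  | h (k : ℕ) : RowVar m (tapeRow m + 10 * k) (.h k)
  | S (k : ℕ) : RowVar m (tapeRow m + 10 * k + 6) (.S k)
  | p (k : ℕ) : RowVar m (tapeRow m + 10 * (k + 1) + 8) (.h k)
  | pFirst : RowVar m (tapeRow m + 8) .pFirst

/-- The sites of the gear bits that represent the variable `v`. -/
def Machine.bitsOf {m : ℕ} (M : Machine m) (v : Var m) : Set Site :=
  {p | M.board.piece p = some .gearBit ∧ RowVar m (p.2 / 4) v}

/-- In the setting `σ` of the bits, the variable `v` is set to `b`: all gear bits that represent it
show `b`. -/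
def Machine.Shows {m : ℕ} (M : Machine m) (σ : Site → Bool) (v : Var m) (b : Bool) : Prop :=
  (M.bitsOf v).Nonempty ∧ ∀ p ∈ M.bitsOf v, σ p = b

/-- The variables that are initially `1` on input `w`: the first state variable, `h` of the first
3-cell, and `S` of the 3-cells whose cell holds the symbol `1`. -/
inductive InitiallyOne {m : ℕ} (w : List Bool) : Var m → Prop where
  | Q : InitiallyOne w (.Q 0)
  | h : InitiallyOne w (.h 0)
  | S (k : ℕ) (hk : w.getD k false = true) : InitiallyOne w (.S k)

open Classical in
/-- The initial setting of the bits on input `w`. -/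
noncomputable def Machine.setup {m : ℕ} (M : Machine m) (w : List Bool) : Site → Bool :=
  fun p => decide (∃ v, p ∈ M.bitsOf v ∧ InitiallyOne w v)

/-- The board with input `w`, `t` ticks after the query trigger was pressed. -/
noncomputable def Machine.simulation {m : ℕ} (M : Machine m) (w : List Bool) (t : ℕ) : State :=
  M.board.run (M.setup w) .query t

end TuringTumble

/-!
The board is followed through one step of the machine, i.e. through one Q-ball and one `0`- or
`1`-ball, and the values of its gear bits are described by a function `f : Var m → Bool`
(`Machine.Encodes`).

*Gears.* A gear bit turns with exactly the gear bits of its own variable. To separate the variables,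
every block is labelled by the first block row of the variable whose gears it contains
(`gearLabel`). Teeth meet across the border of two blocks only in gear rows or gear columns, and
there the labels agree (`gearLabel_row`, `gearLabel_south`), so linked gear bits belong to the same
variable (`eq_of_linked`). Conversely, every gear bit of a variable is linked with a fixed gear of
it along a gear row, or along a gear chain followed by a gear row (`linked_root`).
Hence turning a gear bit flips one value of `f` (`encodes_turn`).

*Blocks.* Inside a block, only the value of the variable of its row matters. So the motion of a ball
through a block is the iteration of a function on a small local state (`Block.roll`), which can be
evaluated for each of the blocks; `leads_roll` transfers the result to the board.

*Routes.* The Q-ball descends the bus to the 3-cell with `h = 1`, reads `S` there and releases the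
ball of the symbol read (`query_phase`). In the tree below its hopper, that ball sets the variables
`Q 0, …, Q (i - 1)` before the current state `i` to `1` and `Q i` to `0`, which does no harm, since
all of them are written again in the rows `Q'` (`enter_stm`). The router takes it to the bus line of
the action (`enter_router`), and in the scanned 3-cell it moves `h`, writes `S` and releases the
next Q-ball (`action_phase`). The values then represent the next configuration.

The number of intercepted balls never decreases, and the tick after which the values are inspected
increases it to `2 n`, so it is the first such moment (`simulation_after`).
-/

namespace TuringTumble

/-! ### Teeth of blocks and labels of gears -/

/-- The part in row `b` and column `a` of a block is a gear or a gear bit. -/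
def Block.Tooth (B : Block) (b a : Fin 4) : Prop :=
  B.picture b a = some .gear ∨ B.picture b a = some .gearBit

instance (B : Block) (b a : Fin 4) : Decidable (B.Tooth b a) := by
  unfold Block.Tooth; infer_instance

/-- The blocks whose top row consists of gears and gear bits. -/
def Block.isRow : Block → Bool
  | .gearRow | .ignore | .write _ | .readBranch | .writeBranch | .treeRead | .haltCatch
  | .query => true
  | _ => false

/-- The blocks that contain a gear bit. -/
def Block.hasBit : Block → Bool
  | .ignore | .write _ | .readBranch | .writeBranch | .treeRead | .haltCatch | .query => true
  | _ => false

/-- A gear row in the block reaches its right border. -/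
def Block.opensEast (B : Block) : Bool := B.isRow || B = .bendSE || B = .bendNE
/-- A gear row in the block reaches its left border. -/
def Block.opensWest (B : Block) : Bool := B.isRow || B = .bendSW || B = .bendNW
/-- A gear column in the block reaches its lower border. -/
def Block.opensSouth (B : Block) : Bool := B = .gearCol || B = .bendSE || B = .bendSW
/-- The block has a tooth at the third site of its top row. Every block with teeth does. -/
def Block.opensNorth (B : Block) : Bool :=
  B.opensEast || B.opensWest || B.opensSouth

theorem Block.tooth_east {B : Block} {b : Fin 4} (h : B.Tooth b 3) : B.opensEast := by
  revert h b; rcases B with _ | _ | _ | _ | _ | _ | _ | _ | _ | _ | _ | _ | (_ | _) <;> decide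

theorem Block.tooth_west {B : Block} {b : Fin 4} (h : B.Tooth b 0) : B.opensWest := by
  revert h b; rcases B with _ | _ | _ | _ | _ | _ | _ | _ | _ | _ | _ | _ | (_ | _) <;> decide

theorem Block.tooth_south {B : Block} {a : Fin 4} (h : B.Tooth 3 a) : B.opensSouth := by
  revert h a; rcases B with _ | _ | _ | _ | _ | _ | _ | _ | _ | _ | _ | _ | (_ | _) <;> decide

theorem Block.hasBit_of_picture {B : Block} {b a : Fin 4} (h : B.picture b a = some .gearBit) :
    B.hasBit := by
  revert b a
  rcases B with _ | _ | _ | _ | _ | _ | _ | _ | _ | _ | _ | _ | (_ | _) <;>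
    first | exact fun _ => rfl | (intro b a; fin_cases b <;> fin_cases a <;> decide)

theorem Block.east_of_hasBit {B : Block} (h : B.hasBit) : B.opensEast := by
  revert h; rcases B with _ | _ | _ | _ | _ | _ | _ | _ | _ | _ | _ | _ | (_ | _) <;> decide

/-- The first block row with gear bits of the variable that is represented in block row `r`: the row
of `Q i` for a row of `Q' i`, and the row of `h` of the previous 3-cell for a row of `p`, except in
the first 3-cell. In a row without gear bits the value is irrelevant. -/
def rowLabel (m r : ℕ) : ℕ :=
  if r < 2 * (m + 1) then r
  else if r < 3 * (m + 1) then 2 * (3 * (m + 1) - 1 - r)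
  else if (r - tapeRow m) % 10 = 8 ∧ 18 ≤ r - tapeRow m then r - 18 else r

/-- The label of block row `r` in the column of the gear chain number `e` of the State Transition
Module: between the two ends of the chain, it is the label of `Q e`. -/
def chainLabel (m e r : ℕ) : ℕ :=
  if 2 * e ≤ r ∧ r ≤ 3 * (m + 1) - 1 - e then 2 * e else rowLabel m r

/-- A label of the block `(X, r)` that is constant along linked gears: the first block row with gear
bits of the variable to which the gears of the block belong. For a block without teeth it is
irrelevant. -/
def gearLabel (m : ℕ) (X : ℤ) (r : ℕ) : ℕ :=
  if r < 3 * (m + 1) then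
    if X < -3 * (m + 1) then chainLabel m (X + 4 * (m + 1)).toNat r
    else if X < -(m + 1) then rowLabel m r
    else chainLabel m (-1 - X).toNat r
  else
    let k := (r - tapeRow m) / 10
    if X = -1 ∨ X = 11 then
      if (X = -1 ↔ k % 2 = 0) then
        if k = 0 then tapeRow m + 8 else tapeRow m + 10 * (k - 1)
      else tapeRow m + 10 * k
    else rowLabel m r

theorem chainBlock_row {m e r : ℕ} {t b : Block} (he : e ≤ m) (hr : r < 3 * (m + 1))
    (h : (chainBlock m e r t b).opensEast ∨ (chainBlock m e r t b).opensWest) :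
    chainLabel m e r = rowLabel m r := by
  revert h
  unfold chainBlock chainLabel rowLabel
  split_ifs <;> first | (intro h; exact absurd h (by decide)) | omega

theorem chainBlock_south {m e r : ℕ} {t b : Block} (he : e ≤ m) (hr : r < 3 * (m + 1))
    (hb : b.opensSouth = false)
    (h : (chainBlock m e r t b).opensSouth) :
    r + 1 < 3 * (m + 1) ∧ chainLabel m e r = chainLabel m e (r + 1) := by
  revert h
  unfold chainBlock chainLabel rowLabel
  split_ifs <;> first | (intro h; exact absurd h (by decide)) | omega | (simp [hb])

theorem treeBlock_south {m : ℕ} (M : Machine m) {b : Bool} {i r : ℕ} :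
    (M.treeBlock b i r).opensSouth = false := by
  unfold Machine.treeBlock
  split_ifs <;> try rfl
  split <;> rfl

theorem routerBlock_row {m : ℕ} (M : Machine m) {X : ℤ} {r : ℕ} :
    (M.routerBlock X r).opensNorth = false := by
  unfold Machine.routerBlock
  simp only
  split <;> split_ifs <;> rfl

theorem cellBlock_left {k j : ℕ} :
    cellBlock k j (-1) =
      if k % 2 = 0 then if j < 8 then if k = 0 then .blank else .gearCol
        else if j = 8 then .bendNE else .blank
      else if j = 0 then .bendSE else .gearCol := by
  unfold cellBlock
  exact if_pos rfl

theorem cellBlock_right {k j : ℕ} :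
    cellBlock k j 11 =
      if k % 2 = 0 then if j = 0 then .bendSW else .gearCol
      else if j < 8 then .gearCol else if j = 8 then .bendNW else .blank := by
  unfold cellBlock
  simp only
  rw [if_neg (by decide), if_pos trivial]

theorem cellBlock_bus {k j : ℕ} {X : ℤ} (h0 : 0 ≤ X) (h4 : X ≤ 4) :
    cellBlock k j X =
      if j = 0 then if X = 4 then .readBranch else .writeBranch
      else if j ≤ 4 ∧ (j : ℤ) ≤ X then .cross
      else if j = 8 ∧ k % 2 = 0 then .ignore
      else .pass := by
  unfold cellBlock
  simp only
  rw [if_neg (by omega), if_neg (by omega), if_pos ⟨h0, h4⟩]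

theorem cellBlock_inside {k j : ℕ} {X : ℤ} (h0 : 5 ≤ X) (h4 : X ≤ 10) :
    cellBlock k j X =
      if j = 0 then
        if X = 7 ∨ X = 8 then .write true
        else if X ≤ 6 ∨ k % 2 = 0 then .gearRow
        else .blank
      else if j = 1 ∧ (X = 7 ∨ X = 8) then .fire
      else if j ≤ 4 then (if X ≤ j + 4 then .diagonal else .blank)
      else if j = 5 then (if X ≤ 9 then .merge else .blank)
      else if j = 6 then
        if X = 5 ∨ X = 7 then .write false
        else if X = 6 ∨ X = 8 then .write true
        else if X = 9 then .query
        else .blank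
      else if j = 7 then (if X ≤ 8 then .pass else .net)
      else if j = 8 then
        if X ≤ 6 then .write true
        else if X ≤ 8 then .write false
        else if k % 2 = 0 then .blank
        else .gearRow
      else if X ≤ 6 then .fire
      else if X ≤ 8 then .pass
      else .blank := by
  unfold cellBlock
  simp only
  rw [if_neg (by omega), if_neg (by omega), if_neg (by omega), if_pos ⟨h0, h4⟩]

theorem cellBlock_outside {k j : ℕ} {X : ℤ} (h : X < -1 ∨ 11 < X) :
    cellBlock k j X = .blank := by
  unfold cellBlock
  simp only
  rw [if_neg (by omega), if_neg (by omega), if_neg (by omega), if_neg (by omega)]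

theorem cellBlock_cases (X : ℤ) :
    X = -1 ∨ X = 11 ∨ (0 ≤ X ∧ X ≤ 4) ∨ (5 ≤ X ∧ X ≤ 10) ∨ (X < -1 ∨ 11 < X) := by omega

theorem cellBlock_row {k j : ℕ} {X : ℤ}
    (h : (cellBlock k j X).opensEast ∨ (cellBlock k j X).opensWest) :
    (X = -1 → (k % 2 = 0 → j = 8) ∧ (k % 2 = 1 → j = 0)) ∧
    (X = 11 → (k % 2 = 0 → j = 0) ∧ (k % 2 = 1 → j = 8)) ∧ -1 ≤ X ∧ X ≤ 11 ∧
    (j = 0 ∨ j = 6 ∨ j = 8) := by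
  revert h
  rcases cellBlock_cases X with rfl | rfl | h | h | h
  · rw [cellBlock_left]
    split_ifs <;>
      first
      | (intro h; exact absurd h (by decide))
      | (refine fun _ => ⟨fun _ => ⟨fun _ => ?_, fun _ => ?_⟩,
          fun _ => ⟨fun _ => ?_, fun _ => ?_⟩, ?_, ?_, ?_⟩ <;>
            first | omega | contradiction)
  · rw [cellBlock_right]
    split_ifs <;>
      first
      | (intro h; exact absurd h (by decide))
      | (refine fun _ => ⟨fun _ => ⟨fun _ => ?_, fun _ => ?_⟩,
          fun _ => ⟨fun _ => ?_, fun _ => ?_⟩, ?_, ?_, ?_⟩ <;>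
            first | omega | contradiction)
  · rw [cellBlock_bus h.1 h.2]
    split_ifs <;> first | (intro h; exact absurd h (by decide)) | omega
  · rw [cellBlock_inside h.1 h.2]
    split_ifs <;> first | (intro h; exact absurd h (by decide)) | omega
  · rw [cellBlock_outside h]
    intro h; exact absurd h (by decide)

theorem cellBlock_south {k j : ℕ} {X : ℤ}
    (h : (cellBlock k j X).opensSouth) :
    (X = -1 ∧ (k % 2 = 0 → k ≠ 0 ∧ j < 8)) ∨ (X = 11 ∧ (k % 2 = 1 → j < 8)) := by
  revert h
  rcases cellBlock_cases X with rfl | rfl | h | h | h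
  · rw [cellBlock_left]
    split_ifs <;> first | (intro h; exact absurd h (by decide)) | omega
  · rw [cellBlock_right]
    split_ifs <;> first | (intro h; exact absurd h (by decide)) | omega
  · rw [cellBlock_bus h.1 h.2]
    split_ifs <;> (intro h; exact absurd h (by decide))
  · rw [cellBlock_inside h.1 h.2]
    split_ifs <;> (intro h; exact absurd h (by decide))
  · rw [cellBlock_outside h]
    intro h; exact absurd h (by decide)

theorem Block.opens_imp {B : Block} :
    (B.opensEast → B.opensNorth) ∧ (B.opensWest → B.opensNorth) ∧
      (B.opensSouth → B.opensNorth) := by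
  rcases B with _ | _ | _ | _ | _ | _ | _ | _ | _ | _ | _ | _ | (_ | _) <;> decide

/-- Where a gear row crosses a border between two blocks, the labels agree, because both are the
label of the block row. -/
theorem gearLabel_row {m : ℕ} (M : Machine m) {X : ℤ} {r : ℕ}
    (h : (M.block X r).opensEast ∨ (M.block X r).opensWest) :
    gearLabel m X r = rowLabel m r := by
  unfold Machine.block at h
  split_ifs at h with h1 h2
  · unfold Machine.stmBlock at h
    unfold gearLabel
    rw [if_pos h1.2]
    split_ifs at h with a1 a2 a3 a4
    · exact absurd h (by decide)
    · rw [if_pos a2]; exact chainBlock_row (by omega) h1.2 h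
    · rw [if_neg a2, if_pos (by omega)]
    · rw [if_neg a2, if_pos (by omega)]
    · rw [if_neg a2, if_neg (by omega)]; exact chainBlock_row (by omega) h1.2 h
  · have := routerBlock_row M (X := X) (r := r)
    have h3 := Block.opens_imp (B := M.routerBlock X r)
    simp [this] at h3; simp [h3] at h
  · have := cellBlock_row h
    unfold gearLabel rowLabel
    unfold tapeRow at *
    simp only
    split_ifs at * <;> omega

theorem gearLabel_south {m : ℕ} (M : Machine m) {X : ℤ} {r : ℕ}
    (h : (M.block X r).opensSouth) :
    gearLabel m X r = gearLabel m X (r + 1) := by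
  unfold Machine.block at h
  split_ifs at h with h1 h2
  · unfold Machine.stmBlock at h
    unfold gearLabel
    rw [if_pos h1.2]
    split_ifs at h with a1 a2 a3 a4
    · exact absurd h (by decide)
    · obtain ⟨h3, h4⟩ := chainBlock_south (by omega) h1.2 (by decide) h
      rw [if_pos a2, if_pos h3, if_pos a2, h4]
    · simp [treeBlock_south] at h
    · simp [treeBlock_south] at h
    · obtain ⟨h3, h4⟩ := chainBlock_south (by omega) h1.2 (by decide) h
      rw [if_neg a2, if_neg (by omega), if_pos h3, if_neg a2, if_neg (by omega), h4]
  · have := routerBlock_row M (X := X) (r := r)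
    have h3 := Block.opens_imp (B := M.routerBlock X r)
    simp [this] at h3; simp [h3] at h
  · have := cellBlock_south h
    unfold gearLabel
    unfold tapeRow at *
    simp only
    split_ifs at * <;> omega

/-! ### Sites -/

/-- The site in column `a` and row `b` of the block `(X, r)`. Coordinates beyond `3` are allowed;
they belong to a neighbouring block. -/
def site (X : ℤ) (r : ℕ) (a : ℤ) (b : ℕ) : Site := (4 * X + a, 4 * r + b)

/-- The site at which a line running down enters the block `(X, r)`. -/
abbrev entry (X : ℤ) (r : ℕ) : Site := site X r 2 0

theorem piece_site {m : ℕ} (M : Machine m) (X : ℤ) (r : ℕ) (a b : Fin 4) :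
    M.board.piece (site X r (a.val : ℤ) b.val) = (M.block X r).picture b a := by
  have ha := a.isLt
  have hb := b.isLt
  have e1 : (4 * X + (a.val : ℤ)) / 4 = X := by omega
  have e2 : (4 * r + b.val) / 4 = r := by omega
  have e3 : Fin.ofNat 4 (4 * r + b.val) = b := by
    apply Fin.ext; simp only [Fin.val_ofNat]; omega
  have e4 : Fin.ofNat 4 ((4 * X + (a.val : ℤ)) % 4).toNat = a := by
    apply Fin.ext; simp only [Fin.val_ofNat]; omega
  simp only [Machine.board, site, e1, e2, e3, e4]

theorem exists_site (p : Site) : ∃ X r, ∃ a b : Fin 4, p = site X r (a.val : ℤ) b.val := by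
  refine ⟨p.1 / 4, p.2 / 4, ⟨(p.1 % 4).toNat, by omega⟩, ⟨p.2 % 4, by omega⟩, ?_⟩
  ext <;> simp only [site] <;> omega

theorem toothed_site {m : ℕ} (M : Machine m) (X : ℤ) (r : ℕ) (a b : Fin 4) :
    M.board.Toothed (site X r (a.val : ℤ) b.val) ↔ (M.block X r).Tooth b a := by
  unfold Board.Toothed Block.Tooth
  rw [piece_site]

theorem site_div (X : ℤ) (r : ℕ) (a b : Fin 4) :
    (site X r (a.val : ℤ) b.val).1 / 4 = X ∧ (site X r (a.val : ℤ) b.val).2 / 4 = r := by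
  simp only [site]; omega

/-! ### Separate variables are not linked -/

theorem gearLabel_meshed {m : ℕ} (M : Machine m) {p q : Site} (h : M.board.Meshed p q) :
    gearLabel m (p.1 / 4) (p.2 / 4) = gearLabel m (q.1 / 4) (q.2 / 4) := by
  obtain ⟨X, r, a, b, rfl⟩ := exists_site p
  obtain ⟨X', r', a', b', rfl⟩ := exists_site q
  obtain ⟨hp, hq, h⟩ := h
  rw [toothed_site] at hp hq
  rw [(site_div X r a b).1, (site_div X r a b).2, (site_div X' r' a' b').1,
    (site_div X' r' a' b').2]
  have ha := a.isLt
  have hb := b.isLt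
  have ha' := a'.isLt
  have hb' := b'.isLt
  simp only [site] at h
  -- Either both sites belong to the same block, or they face each other across a common border.
  have h5 : (X = X' ∧ r = r') ∨ (r = r' ∧ X' = X + 1 ∧ a.val = 3 ∧ a'.val = 0) ∨
      (r = r' ∧ X = X' + 1 ∧ a'.val = 3 ∧ a.val = 0) ∨
      (X = X' ∧ r' = r + 1 ∧ b.val = 3) ∨ (X = X' ∧ r = r' + 1 ∧ b'.val = 3) := by
    omega
  rcases h5 with ⟨rfl, rfl⟩ | ⟨rfl, rfl, h1, h2⟩ | ⟨rfl, rfl, h1, h2⟩ | ⟨rfl, rfl, h1⟩ |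
    ⟨rfl, rfl, h1⟩
  · rfl
  · obtain rfl : a = 3 := Fin.ext h1
    obtain rfl : a' = 0 := Fin.ext h2
    rw [gearLabel_row M (.inl (Block.tooth_east hp)), gearLabel_row M (.inr (Block.tooth_west hq))]
  · obtain rfl : a' = 3 := Fin.ext h1
    obtain rfl : a = 0 := Fin.ext h2
    rw [gearLabel_row M (.inl (Block.tooth_east hq)), gearLabel_row M (.inr (Block.tooth_west hp))]
  · obtain rfl : b = 3 := Fin.ext h1
    exact gearLabel_south M (Block.tooth_south hp)
  · obtain rfl : b' = 3 := Fin.ext h1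
    exact (gearLabel_south M (Block.tooth_south hq)).symm

theorem gearLabel_linked {m : ℕ} (M : Machine m) {p q : Site} (h : M.board.Linked p q) :
    gearLabel m (p.1 / 4) (p.2 / 4) = gearLabel m (q.1 / 4) (q.2 / 4) := by
  induction h with
  | refl => rfl
  | tail _ h ih => rw [ih, gearLabel_meshed M h]

/-- The first block row with gear bits of a variable. -/
def Var.label {m : ℕ} : Var m → ℕ
  | .Q i => 2 * i
  | .h k => tapeRow m + 10 * k
  | .S k => tapeRow m + 10 * k + 6
  | .pFirst => tapeRow m + 8

theorem Var.label_injective {m : ℕ} : Function.Injective (Var.label (m := m)) := by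
  intro v w h
  cases v <;> cases w <;> simp only [Var.label, tapeRow] at h <;>
    first
    | rfl
    | (exfalso; omega)
    | (congr 1; omega)

theorem rowLabel_eq {m r : ℕ} {v : Var m} (h : RowVar m r v) : rowLabel m r = v.label := by
  cases h
  case Q i => rw [rowLabel, if_pos (by omega)]; rfl
  case Q' i =>
    rw [rowLabel, if_neg (by omega), if_pos (by omega)]
    simp only [Var.label]; omega
  all_goals
    rw [rowLabel, if_neg (by unfold tapeRow; omega), if_neg (by unfold tapeRow; omega)]
  case h k => rw [if_neg (by omega)]; rfl
  case S k => rw [if_neg (by omega)]; rfl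
  case p k => rw [if_pos (by omega)]; simp only [Var.label]; omega
  case pFirst => rw [if_neg (by omega)]; rfl

theorem gearLabel_bitsOf {m : ℕ} (M : Machine m) {v : Var m} {p : Site} (h : p ∈ M.bitsOf v) :
    gearLabel m (p.1 / 4) (p.2 / 4) = v.label := by
  obtain ⟨X, r, a, b, rfl⟩ := exists_site p
  obtain ⟨h1, h2⟩ := h
  rw [← rowLabel_eq h2]
  rw [(site_div X r a b).1, (site_div X r a b).2]
  rw [piece_site] at h1
  exact gearLabel_row M (.inl (Block.east_of_hasBit (Block.hasBit_of_picture h1)))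

theorem eq_of_linked {m : ℕ} (M : Machine m) {v w : Var m} {p q : Site} (hp : p ∈ M.bitsOf v)
    (hq : q ∈ M.bitsOf w) (h : M.board.Linked p q) : v = w :=
  Var.label_injective (by
    rw [← gearLabel_bitsOf M hp, ← gearLabel_bitsOf M hq, gearLabel_linked M h])

theorem bitsOf_unique {m : ℕ} (M : Machine m) {v w : Var m} {p : Site} (hp : p ∈ M.bitsOf v)
    (hq : p ∈ M.bitsOf w) : v = w :=
  eq_of_linked M hp hq .refl

/-! ### All gear bits of a variable are linked -/

theorem Block.tooth_of_opensEast {B : Block} (h : B.opensEast) : B.Tooth 0 2 ∧ B.Tooth 0 3 := by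
  revert h; rcases B with _ | _ | _ | _ | _ | _ | _ | _ | _ | _ | _ | _ | (_ | _) <;> decide

theorem Block.tooth_of_opensWest {B : Block} (h : B.opensWest) :
    B.Tooth 0 0 ∧ B.Tooth 0 1 ∧ B.Tooth 0 2 := by
  revert h; rcases B with _ | _ | _ | _ | _ | _ | _ | _ | _ | _ | _ | _ | (_ | _) <;> decide

theorem Block.tooth_of_opensSouth {B : Block} (h : B.opensSouth) :
    B.Tooth 0 2 ∧ B.Tooth 1 2 ∧ B.Tooth 2 2 ∧ B.Tooth 3 2 := by
  revert h; rcases B with _ | _ | _ | _ | _ | _ | _ | _ | _ | _ | _ | _ | (_ | _) <;> decide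

theorem Block.tooth_of_opensNorth {B : Block} (h : B.opensNorth) : B.Tooth 0 2 := by
  revert h; rcases B with _ | _ | _ | _ | _ | _ | _ | _ | _ | _ | _ | _ | (_ | _) <;> decide

theorem Block.bit_position {B : Block} {b a : Fin 4} (h : B.picture b a = some .gearBit) :
    B.Tooth 0 2 ∧ B.Tooth b a ∧
      ((b = 0 ∧ a = 2) ∨ (b = 1 ∧ (a = 1 ∨ a = 3) ∧ B.Tooth 1 2)) := by
  refine ⟨?_, .inr h, ?_⟩
  · have h1 := Block.east_of_hasBit (Block.hasBit_of_picture h)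
    exact (Block.tooth_of_opensEast h1).1
  revert b a
  rcases B with _ | _ | _ | _ | _ | _ | _ | _ | _ | _ | _ | _ | (_ | _) <;>
    (intro b a; fin_cases b <;> fin_cases a <;> decide)

theorem Board.Meshed.symm {B : Board} {p q : Site} (h : B.Meshed p q) : B.Meshed q p := by
  obtain ⟨h1, h2, h3⟩ := h
  refine ⟨h2, h1, ?_⟩
  omega

theorem Board.Linked.symm {B : Board} {p q : Site} (h : B.Linked p q) : B.Linked q p := by
  induction h with
  | refl => exact .refl
  | tail _ h ih => exact .head h.symm ih

theorem Board.Linked.trans {B : Board} {p q r : Site} (h : B.Linked p q) (h' : B.Linked q r) :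
    B.Linked p r :=
  Relation.ReflTransGen.trans h h'

section
variable {m : ℕ} (M : Machine m)

theorem linked_of_tooth {X : ℤ} {r : ℕ} (a b a' b' : Fin 4) (h : (M.block X r).Tooth b a)
    (h' : (M.block X r).Tooth b' a')
    (hm : (b = b' ∧ (a.val + 1 = a'.val ∨ a'.val + 1 = a.val)) ∨
      (a = a' ∧ (b.val + 1 = b'.val ∨ b'.val + 1 = b.val))) :
    M.board.Linked (site X r (a.val : ℤ) b.val) (site X r (a'.val : ℤ) b'.val) := by
  refine .single ⟨(toothed_site M X r a b).2 h, (toothed_site M X r a' b').2 h', ?_⟩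
  simp only [site]
  omega

theorem linked_east {X : ℤ} {r : ℕ} (h : (M.block X r).opensEast)
    (h' : (M.block (X + 1) r).opensWest) : M.board.Linked (entry X r) (entry (X + 1) r) := by
  obtain ⟨h2, h3⟩ := Block.tooth_of_opensEast h
  obtain ⟨k0, k1, k2⟩ := Block.tooth_of_opensWest h'
  have e1 := linked_of_tooth M 2 0 3 0 h2 h3 (by decide)
  have e2 := linked_of_tooth M 0 0 1 0 k0 k1 (by decide)
  have e3 := linked_of_tooth M 1 0 2 0 k1 k2 (by decide)
  refine e1.trans (.trans (.single ⟨(toothed_site M X r 3 0).2 h3,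
    (toothed_site M (X + 1) r 0 0).2 k0, ?_⟩) (e2.trans e3))
  simp [site]
  omega

theorem linked_south {X : ℤ} {r : ℕ} (h : (M.block X r).opensSouth)
    (h' : (M.block X (r + 1)).opensNorth) : M.board.Linked (entry X r) (entry X (r + 1)) := by
  obtain ⟨h0, h1, h2, h3⟩ := Block.tooth_of_opensSouth h
  have k0 := Block.tooth_of_opensNorth h'
  have e1 := linked_of_tooth M 2 0 2 1 h0 h1 (by decide)
  have e2 := linked_of_tooth M 2 1 2 2 h1 h2 (by decide)
  have e3 := linked_of_tooth M 2 2 2 3 h2 h3 (by decide)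
  refine e1.trans (e2.trans (e3.trans (.single ⟨(toothed_site M X r 2 3).2 h3,
    (toothed_site M X (r + 1) 2 0).2 k0, ?_⟩)))
  simp [site]
  omega

/-- A gear bit in the second row of a block is connected with the top row by the gear between the
two sites of that row. -/
theorem linked_bit {X : ℤ} {r : ℕ} {a b : Fin 4} (h : (M.block X r).picture b a = some .gearBit) :
    M.board.Linked (entry X r) (site X r (a.val : ℤ) b.val) := by
  obtain ⟨h0, h1, ⟨rfl, rfl⟩ | ⟨rfl, h2, h3⟩⟩ := Block.bit_position h
  · exact .refl
  · refine (linked_of_tooth M 2 0 2 1 h0 h3 (by decide)).trans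
      (linked_of_tooth M 2 1 a 1 h3 h1 ?_)
    rcases h2 with rfl | rfl <;> decide

theorem linked_row {r : ℕ} {x y : ℤ}
    (hE : ∀ X, x ≤ X → X < y → (M.block X r).opensEast)
    (hW : ∀ X, x < X → X ≤ y → (M.block X r).opensWest) {X Y : ℤ} (hX : x ≤ X) (hX' : X ≤ y)
    (hY : x ≤ Y) (hY' : Y ≤ y) : M.board.Linked (entry X r) (entry Y r) := by
  have key : ∀ Z, x ≤ Z → Z ≤ y → M.board.Linked (entry x r) (entry Z r) := by
    intro Z hZ
    induction Z, hZ using Int.leInduction with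
    | base => exact fun _ => .refl
    | succ Z hZ ih =>
      exact fun hZ' => (ih (by omega)).trans
        (linked_east M (hE Z hZ (by omega)) (hW (Z + 1) (by omega) hZ'))
  exact (key X hX hX').symm.trans (key Y hY hY')

theorem linked_col {X : ℤ} {r s : ℕ} (hrs : r ≤ s)
    (hS : ∀ t, r ≤ t → t < s → (M.block X t).opensSouth)
    (hN : (M.block X s).opensNorth) : M.board.Linked (entry X r) (entry X s) := by
  have key : ∀ t, r ≤ t → t ≤ s → M.board.Linked (entry X r) (entry X t) := by
    intro t ht
    induction t, ht using Nat.le_induction with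
    | base => exact fun _ => .refl
    | succ t ht ih =>
      refine fun ht' => (ih (by omega)).trans (linked_south M (hS t ht (by omega)) ?_)
      rcases Nat.lt_or_ge (t + 1) s with h | h
      · exact Block.opens_imp.2.2 (hS (t + 1) (by omega) h)
      · obtain rfl : t + 1 = s := by omega
        exact hN
  exact key s hrs le_rfl

theorem block_cell (k j : ℕ) (hj : j < 10) (X : ℤ) :
    M.block X (tapeRow m + 10 * k + j) = cellBlock k j X := by
  unfold Machine.block
  rw [if_neg (by unfold tapeRow; omega), if_neg (by omega)]
  congr 1 <;> omega

theorem block_left (e r : ℕ) (he : e ≤ m) (hr : r < 3 * (m + 1)) :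
    M.block (-4 * (m + 1) + e) r = chainBlock m e r .bendSE .bendNE := by
  unfold Machine.block Machine.stmBlock
  rw [if_pos (by omega), if_neg (by omega), if_pos (by omega)]
  congr 1; omega

theorem block_tree (b : Bool) (i r : ℕ) (hi : i ≤ m) (hr : r < 3 * (m + 1)) :
    M.block ((if b then -2 else -3) * (m + 1) + i) r = M.treeBlock b i r := by
  unfold Machine.block Machine.stmBlock
  cases b
  · rw [if_pos (by simp; omega), if_neg (by simp; omega), if_neg (by simp),
      if_pos (by simp; omega)]
    congr 1; simp
  · rw [if_pos (by simp; omega), if_neg (by simp; omega), if_neg (by simp; omega),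
      if_neg (by simp), if_pos (by simp; omega)]
    congr 1; simp

theorem treeBlock_isRow (b : Bool) (i r : ℕ) (h : r < 2 * (m + 1) → r % 2 = 0) :
    (M.treeBlock b i r).isRow := by
  unfold Machine.treeBlock
  split_ifs with h1 <;> try rfl
  · exact absurd (h h1) (by assumption)
  · exact absurd (h h1) (by assumption)
  · exact absurd (h h1) (by assumption)
  · split <;> rfl

theorem Block.hasBit_opens {B : Block} (h : B.hasBit) : B.opensNorth :=
  Block.opens_imp.1 (Block.east_of_hasBit h)

theorem hasBit_stm {X : ℤ} {r : ℕ} (hr : r < tapeRow m) (h : (M.block X r).hasBit) :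
    -3 * (m + 1) ≤ X ∧ X < -(m + 1) ∧ r < 3 * (m + 1) := by
  unfold Machine.block at h
  split_ifs at h with h1
  · unfold Machine.stmBlock at h
    have hc : ∀ e t b, t.hasBit = false → b.hasBit = false →
        (chainBlock m e r t b).hasBit = false := by
      intro e t b ht hb
      unfold chainBlock
      split_ifs <;> first | assumption | rfl
    split_ifs at h with a1 a2 a3 a4
    · exact absurd h (by decide)
    · rw [hc _ _ _ rfl rfl] at h; exact absurd h (by decide)
    · omega
    · omega
    · rw [hc _ _ _ rfl rfl] at h; exact absurd h (by decide)
  · have := Block.hasBit_opens h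
    rw [routerBlock_row] at this
    exact absurd this (by decide)

theorem hasBit_cell {k j : ℕ} {X : ℤ} (h : (cellBlock k j X).hasBit) :
    0 ≤ X ∧ X ≤ 9 ∧ (j = 6 → 5 ≤ X) ∧ (j = 0 → X ≤ 8) ∧ (j = 8 → X ≤ 8 ∧ (k % 2 = 1 → 5 ≤ X)) := by
  revert h
  rcases cellBlock_cases X with rfl | rfl | h | h | h
  · rw [cellBlock_left]
    split_ifs <;> (intro h; exact absurd h (by decide))
  · rw [cellBlock_right]
    split_ifs <;> (intro h; exact absurd h (by decide))
  · rw [cellBlock_bus h.1 h.2]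
    split_ifs <;> first | (intro h; exact absurd h (by decide)) | omega
  · rw [cellBlock_inside h.1 h.2]
    split_ifs <;> first | (intro h; exact absurd h (by decide)) | omega
  · rw [cellBlock_outside h]
    intro h; exact absurd h (by decide)

theorem stm_row_opens {i r : ℕ} (hi : i ≤ m) (hr : r = 2 * i ∨ r = 3 * (m + 1) - 1 - i) {X : ℤ}
    (hX : -4 * (m + 1) + i ≤ X) (hX' : X < -(m + 1)) :
    (M.block X r).opensEast ∧ (-4 * (m + 1) + i < X → (M.block X r).opensWest) := by
  have hrow : ∀ {B : Block}, B.isRow → B.opensEast ∧ (-4 * ((m : ℤ) + 1) + i < X → B.opensWest) :=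
    fun h => by simp [Block.opensEast, Block.opensWest, h]
  have htree : r < 2 * (m + 1) → r % 2 = 0 := by omega
  by_cases h1 : X < -3 * (m + 1)
  · obtain ⟨e, rfl⟩ : ∃ e : ℕ, X = -4 * (m + 1) + e := ⟨(X + 4 * (m + 1)).toNat, by omega⟩
    rw [block_left M e r (by omega) (by omega)]
    by_cases h2 : e = i
    · subst h2
      refine ⟨?_, fun h => absurd h (by omega)⟩
      unfold chainBlock
      split_ifs <;> first | rfl | omega
    · apply hrow
      unfold chainBlock
      split_ifs <;> first | rfl | omega
  by_cases h2 : X < -2 * (m + 1)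
  · obtain ⟨e, rfl⟩ : ∃ e : ℕ, X = (if false then -2 else -3) * (m + 1) + e :=
      ⟨(X + 3 * (m + 1)).toNat, by simp; omega⟩
    rw [block_tree M false e r (by simp at h2; omega) (by omega)]
    exact hrow (treeBlock_isRow M _ _ _ htree)
  · obtain ⟨e, rfl⟩ : ∃ e : ℕ, X = (if true then -2 else -3) * (m + 1) + e :=
      ⟨(X + 2 * (m + 1)).toNat, by simp; omega⟩
    rw [block_tree M true e r (by simp at hX'; omega) (by omega)]
    exact hrow (treeBlock_isRow M _ _ _ htree)

theorem cell_row_opens {k j : ℕ} {X : ℤ} {x y : ℤ}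
    (h : j = 0 ∧ k % 2 = 0 ∧ x = 0 ∧ y = 11 ∨ j = 0 ∧ k % 2 = 1 ∧ x = -1 ∧ y = 8 ∨
      j = 6 ∧ x = 5 ∧ y = 9 ∨ j = 8 ∧ k % 2 = 0 ∧ x = -1 ∧ y = 8 ∨
      j = 8 ∧ k % 2 = 1 ∧ x = 5 ∧ y = 11) (hX : x ≤ X) (hX' : X ≤ y) :
    (X < y → (cellBlock k j X).opensEast) ∧ (x < X → (cellBlock k j X).opensWest) := by
  have hrow : ∀ {B : Block}, B.isRow → (X < y → B.opensEast) ∧ (x < X → B.opensWest) :=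
    fun h => by simp [Block.opensEast, Block.opensWest, h]
  rcases cellBlock_cases X with hX1 | hX1 | h1 | h1 | h1
  · refine ⟨fun _ => ?_, fun h' => absurd h' (by omega)⟩
    rw [hX1, cellBlock_left]
    split_ifs <;> first | rfl | omega
  · refine ⟨fun h' => absurd h' (by omega), fun _ => ?_⟩
    rw [hX1, cellBlock_right]
    split_ifs <;> first | rfl | omega
  · apply hrow
    rw [cellBlock_bus h1.1 h1.2]
    split_ifs <;> first | rfl | omega
  · apply hrow
    rw [cellBlock_inside h1.1 h1.2]
    split_ifs <;> first | rfl | omega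
  · omega

theorem linked_cell_row {k j : ℕ} {x y : ℤ}
    (h : j = 0 ∧ k % 2 = 0 ∧ x = 0 ∧ y = 11 ∨ j = 0 ∧ k % 2 = 1 ∧ x = -1 ∧ y = 8 ∨
      j = 6 ∧ x = 5 ∧ y = 9 ∨ j = 8 ∧ k % 2 = 0 ∧ x = -1 ∧ y = 8 ∨
      j = 8 ∧ k % 2 = 1 ∧ x = 5 ∧ y = 11) {X Y : ℤ} (hX : x ≤ X) (hX' : X ≤ y)
    (hY : x ≤ Y) (hY' : Y ≤ y) :
    M.board.Linked (entry X (tapeRow m + 10 * k + j)) (entry Y (tapeRow m + 10 * k + j)) := by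
  apply linked_row M (x := x) (y := y) _ _ hX hX' hY hY'
  · intro Z h1 h2
    rw [block_cell M k j (by omega)]
    exact (cell_row_opens h h1 h2.le).1 h2
  · intro Z h1 h2
    rw [block_cell M k j (by omega)]
    exact (cell_row_opens h h1.le h2).2 h1

theorem linked_stm_row {i r : ℕ} (hi : i ≤ m) (hr : r = 2 * i ∨ r = 3 * (m + 1) - 1 - i) {X Y : ℤ}
    (hX : -4 * (m + 1) + i ≤ X) (hX' : X < -(m + 1))
    (hY : -4 * (m + 1) + i ≤ Y) (hY' : Y < -(m + 1)) :
    M.board.Linked (entry X r) (entry Y r) := by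
  apply linked_row M (x := -4 * (m + 1) + i) (y := -(m + 1) - 1) _ _ hX (by omega) hY (by omega)
  · intro Z h1 h2
    exact (stm_row_opens M hi hr h1 (by omega)).1
  · intro Z h1 h2
    exact (stm_row_opens M hi hr h1.le (by omega)).2 h1

theorem linked_left_chain {i : ℕ} (hi : i ≤ m) :
    M.board.Linked (entry (-4 * (m + 1) + i) (2 * i))
      (entry (-4 * (m + 1) + i) (3 * (m + 1) - 1 - i)) := by
  apply linked_col M (by omega)
  · intro t h1 h2
    rw [block_left M i t hi (by omega)]
    unfold chainBlock
    split_ifs <;> first | rfl | omega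
  · rw [block_left M i _ hi (by omega)]
    unfold chainBlock
    split_ifs <;> first | rfl | omega

/-- The block column of the gear chain that continues the row of `h` of the 3-cell number `k`. -/
def chainColumn (k : ℕ) : ℤ := if k % 2 = 0 then 11 else -1

theorem linked_cell_chain (k : ℕ) :
    M.board.Linked (entry (chainColumn k) (tapeRow m + 10 * k + 0))
      (entry (chainColumn k) (tapeRow m + 10 * (k + 1) + 8)) := by
  have hcol : ∀ t, tapeRow m + 10 * k + 0 ≤ t → t ≤ tapeRow m + 10 * (k + 1) + 8 →
      (t < tapeRow m + 10 * (k + 1) + 8 → (M.block (chainColumn k) t).opensSouth) ∧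
        (M.block (chainColumn k) t).opensNorth := by
    intro t h1 h2
    obtain ⟨k', j, hj, rfl⟩ : ∃ k' j, j < 10 ∧ t = tapeRow m + 10 * k' + j :=
      ⟨(t - tapeRow m) / 10, (t - tapeRow m) % 10, by omega, by omega⟩
    rw [block_cell M k' j hj]
    unfold chainColumn
    by_cases hk : k % 2 = 0
    · rw [if_pos hk, cellBlock_right]
      split_ifs <;> first | exact ⟨fun _ => rfl, rfl⟩ | exact ⟨by omega, rfl⟩ | omega
    · rw [if_neg hk, cellBlock_left]
      split_ifs <;> first | exact ⟨fun _ => rfl, rfl⟩ | exact ⟨by omega, rfl⟩ | omega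
  apply linked_col M (by omega)
  · intro t h1 h2
    exact (hcol t h1 h2.le).1 h2
  · exact (hcol _ (by omega) le_rfl).2

/-- A site of the gears of a variable with which all its gear bits are linked. -/
def Var.root {m : ℕ} : Var m → Site
  | .Q i => entry (-4 * (m + 1) + i.val) (2 * i)
  | .h k => entry (chainColumn k) (tapeRow m + 10 * k + 0)
  | .S k => entry 5 (tapeRow m + 10 * k + 6)
  | .pFirst => entry 0 (tapeRow m + 10 * 0 + 8)

theorem linked_root {v : Var m} {p : Site} (hp : p ∈ M.bitsOf v) : M.board.Linked v.root p := by
  obtain ⟨X, r, a, b, rfl⟩ := exists_site p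
  obtain ⟨h1, h2⟩ := hp
  rw [(site_div X r a b).2] at h2
  rw [piece_site] at h1
  refine Board.Linked.trans ?_ (linked_bit M h1)
  have hb := Block.hasBit_of_picture h1
  cases h2
  case Q i =>
    have := hasBit_stm M (by unfold tapeRow; omega) hb
    exact linked_stm_row M (by omega) (.inl rfl) (by omega) (by omega) (by omega) (by omega)
  case Q' i =>
    have := hasBit_stm M (by unfold tapeRow; omega) hb
    exact (linked_left_chain M (by omega)).trans
      (linked_stm_row M (by omega) (.inr rfl) (by omega) (by omega) (by omega) (by omega))
  case h k =>
    have hb' := hasBit_cell (by rwa [← block_cell M k 0 (by omega)])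
    simp only [Var.root, chainColumn]
    rcases Nat.mod_two_eq_zero_or_one k with hk | hk
    · rw [if_pos hk]
      exact linked_cell_row M (j := 0) (x := 0) (y := 11) (by omega) (by omega) (by omega)
        (by omega) (by omega)
    · rw [if_neg (by omega)]
      exact linked_cell_row M (j := 0) (x := -1) (y := 8) (by omega) (by omega) (by omega)
        (by omega) (by omega)
  case S k =>
    have hb' := hasBit_cell (by rwa [← block_cell M k 6 (by omega)])
    exact linked_cell_row M (j := 6) (x := 5) (y := 9) (by omega) (by omega) (by omega)
        (by omega) (by omega)
  case p k =>
    have hb' := hasBit_cell (by rwa [← block_cell M (k + 1) 8 (by omega)])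
    refine (linked_cell_chain M k).trans ?_
    simp only [chainColumn]
    rcases Nat.mod_two_eq_zero_or_one k with hk | hk
    · rw [if_pos hk]
      exact linked_cell_row M (j := 8) (x := 5) (y := 11) (by omega) (by omega) (by omega)
        (by omega) (by omega)
    · rw [if_neg (by omega)]
      exact linked_cell_row M (j := 8) (x := -1) (y := 8) (by omega) (by omega) (by omega)
        (by omega) (by omega)
  case pFirst =>
    have hb' := hasBit_cell (by rwa [← block_cell M 0 8 (by omega)])
    exact linked_cell_row M (k := 0) (j := 8) (x := -1) (y := 8) (by omega) (by omega) (by omega)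
        (by omega) (by omega)

/-- The gear bits show the values `f` of the variables. -/
def Machine.Encodes (f : Var m → Bool) (σ : Site → Bool) : Prop :=
  ∀ v, ∀ p ∈ M.bitsOf v, σ p = f v

/-- Decidable equality, for `Function.update`. -/
noncomputable instance : DecidableEq (Var m) := Classical.decEq _

/-- Turning a gear bit flips the value of its variable and leaves all other variables unchanged. -/
theorem encodes_turn {f : Var m → Bool} {σ : Site → Bool} (h : M.Encodes f σ) {v : Var m} {p : Site}
    (hp : p ∈ M.bitsOf v) :
    M.Encodes (Function.update f v (!f v)) (M.board.turn p σ) := by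
  intro w q hq
  unfold Board.turn
  by_cases hw : w = v
  · subst hw
    rw [if_pos ⟨hq.1, (linked_root M hp).symm.trans (linked_root M hq)⟩, h _ q hq,
      Function.update_self]
  · rw [if_neg (fun h' => hw (eq_of_linked M hp hq h'.2).symm), h _ q hq,
      Function.update_of_ne hw]

end

/-! ### A ball rolls through a block -/

/-- The state of a ball inside a block: its site, relative to the block, the side it is moving to,
the value of the variable of the block row, and the balls it has triggered. -/
structure Loc where
  a : ℤ
  b : ℕ
  d : Side
  x : Bool
  l : List Hopper

def Loc.move (s : Loc) : Side → Loc
  | .left => { s with a := s.a - 1, b := s.b + 1, d := .left }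
  | .right => { s with a := s.a + 1, b := s.b + 1, d := .right }

/-- One tick inside a block, as long as the ball is neither outside of the block nor caught. -/
def Block.roll (B : Block) (s : Loc) : Loc :=
  if h : (0 ≤ s.a ∧ s.a < 4) ∧ s.b < 4 then
    match B.picture ⟨s.b, h.2⟩ ⟨s.a.toNat, by omega⟩ with
    | none | some .gear => { s with b := s.b + 1 }
    | some (.ramp e) => s.move e
    | some .crossover => s.move s.d
    | some .interceptor | some .bit => s
    | some .gearBit => { s.move (exitSide s.x) with x := !s.x }
    | some (.trigger h) => { s.move s.d with l := s.l ++ [h] }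
  else s

section
variable {m : ℕ} (M : Machine m)

/-- The ball is at the site `p`, moving to the side `d`; the balls `l` are pending, `c` balls have
been intercepted, and the gear bits show `f`. -/
def Machine.At (p : Site) (d : Side) (l : List Hopper) (c : ℕ) (f : Var m → Bool) (s : State) :
    Prop :=
  s.ball = some (p, d) ∧ s.pending = l ∧ s.caught = c ∧ M.Encodes f s.values

/-- From every state satisfying `P`, the board gets to a state satisfying `Q`. -/
def Machine.Leads (P Q : State → Prop) : Prop :=
  ∀ s, P s → ∃ k, Q (M.board.tick^[k] s)

variable {M}

theorem Machine.Leads.refl {P : State → Prop} : M.Leads P P := fun _ h => ⟨0, h⟩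

theorem Machine.Leads.trans {P Q R : State → Prop} (h : M.Leads P Q) (h' : M.Leads Q R) :
    M.Leads P R := by
  intro s hs
  obtain ⟨k, hk⟩ := h s hs
  obtain ⟨k', hk'⟩ := h' _ hk
  exact ⟨k' + k, by rwa [Function.iterate_add_apply]⟩

theorem Machine.Leads.of_imp {P Q : State → Prop} (h : ∀ s, P s → Q s) : M.Leads P Q :=
  fun s hs => ⟨0, h s hs⟩

/-- `Machine.At` for a ball in the local state `s` inside the block `(X, r)`, where `v` is the
variable of the block row. The value of `v` and the balls triggered in the block are read off from
`s`. -/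
def Machine.Place (M : Machine m) (X : ℤ) (r : ℕ) (v : Var m) (l : List Hopper) (c : ℕ)
    (f : Var m → Bool) (s : Loc) : State → Prop :=
  M.At (site X r s.a s.b) s.d (l ++ s.l) c (Function.update f v s.x)

/-- One local tick in a block is simulated by the board. The assumption `hv` says that the gear bits
of the block, if there are any, represent `v`. -/
theorem leads_roll {X : ℤ} {r : ℕ} {v : Var m} {l : List Hopper} {c : ℕ} {f : Var m → Bool}
    (hv : (M.block X r).hasBit → RowVar m r v) (s : Loc) :
    M.Leads (M.Place X r v l c f s) (M.Place X r v l c f ((M.block X r).roll s)) := by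
  unfold Block.roll
  split_ifs with hs
  swap
  · exact .refl
  obtain ⟨a, b, d, x, t⟩ := s
  simp only at hs ⊢
  obtain ⟨a, rfl⟩ : ∃ a' : ℕ, a = (a' : ℤ) := ⟨a.toNat, by omega⟩
  have ha : a < 4 := by omega
  have hp := piece_site M X r ⟨a, ha⟩ ⟨b, hs.2⟩
  simp only [Int.toNat_natCast] at hp ⊢
  have hb : ∀ e, Site.below (site X r a b) e = match e with
      | .left => site X r ((a : ℤ) - 1) (b + 1)
      | .right => site X r ((a : ℤ) + 1) (b + 1) := by
    intro e
    cases e <;> simp only [Site.below, site] <;> ext <;> simp only <;> omega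
  have hd : ((site X r a b).1, (site X r a b).2 + 1) = site X r (a : ℤ) (b + 1) := rfl
  intro s hs'
  obtain ⟨h1, h2, h3, h4⟩ := hs'
  simp only at h1 h2 h4
  have key : ∀ P : State → Prop, P (M.board.tick s) → ∃ k, P (M.board.tick^[k] s) :=
    fun P h => ⟨1, h⟩
  unfold Board.tick at key
  simp only [h1, hp] at key
  split <;> rename_i hq <;> simp only [hq] at key
  · exact key _ ⟨rfl, h2, h3, h4⟩
  · exact key _ ⟨rfl, h2, h3, h4⟩
  · rename_i e
    apply key
    cases e <;> exact ⟨by simp only [hb]; rfl, h2, h3, h4⟩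
  · apply key
    cases d <;> exact ⟨by simp only [hb]; rfl, h2, h3, h4⟩
  · exact ⟨0, h1, h2, h3, h4⟩
  · exact ⟨0, h1, h2, h3, h4⟩
  · apply key
    have hmem : site X r (a : ℤ) b ∈ M.bitsOf v := by
      refine ⟨hp.trans hq, ?_⟩
      rw [(site_div X r ⟨a, ha⟩ ⟨b, hs.2⟩).2]
      exact hv (Block.hasBit_of_picture hq)
    have h5 := encodes_turn M h4 hmem
    rw [Function.update_self, Function.update_idem] at h5
    have h6 := h4 v _ hmem
    rw [Function.update_self] at h6
    rw [h6]
    cases x <;> exact ⟨by simp only [hb]; rfl, h2, h3, h5⟩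
  · rename_i e
    apply key
    cases d <;> exact ⟨by simp only [hb]; rfl, by simp [h2], h3, h4⟩

theorem leads_roll_iterate {X : ℤ} {r : ℕ} {v : Var m} {l : List Hopper} {c : ℕ} {f : Var m → Bool}
    (hv : (M.block X r).hasBit → RowVar m r v) (n : ℕ) (s : Loc) :
    M.Leads (M.Place X r v l c f s) (M.Place X r v l c f ((M.block X r).roll^[n] s)) := by
  induction n generalizing s with
  | zero => exact .refl
  | succ n ih => exact (leads_roll hv s).trans (ih _)

/-- A ball enters the block `(X, r)` from above. -/
def Machine.Enter (M : Machine m) (X : ℤ) (r : ℕ) (l : List Hopper) (c : ℕ) (f : Var m → Bool)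
    (s : State) : Prop :=
  ∃ d, M.At (entry X r) d l c f s

/-- A ball enters the block `(X, r)` diagonally from the upper left. -/
def Machine.Corner (M : Machine m) (X : ℤ) (r : ℕ) (l : List Hopper) (c : ℕ) (f : Var m → Bool)
    (s : State) : Prop :=
  ∃ d, M.At (site X r 0 0) d l c f s

/-- A ball has arrived at an interceptor. -/
def Machine.Stuck (M : Machine m) (l : List Hopper) (c : ℕ) (f : Var m → Bool) (s : State) : Prop :=
  ∃ p d, M.board.piece p = some .interceptor ∧ M.At p d l c f s

/-- No ball is rolling. -/
def Machine.Idle (M : Machine m) (l : List Hopper) (c : ℕ) (f : Var m → Bool) (s : State) : Prop :=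
  s.ball = none ∧ s.pending = l ∧ s.caught = c ∧ M.Encodes f s.values

theorem stuck_tick {l : List Hopper} {c : ℕ} {f : Var m → Bool} {s : State}
    (h : M.Stuck l c f s) : M.Idle l (c + 1) f (M.board.tick s) := by
  obtain ⟨p, d, hp, h1, h2, h3, h4⟩ := h
  simp only [Board.tick, h1, hp]
  exact ⟨rfl, h2, by simp [h3], h4⟩

theorem idle_tick {h : Hopper} {l : List Hopper} {c : ℕ} {f : Var m → Bool} :
    M.Leads (M.Idle (h :: l) c f) (M.At (M.board.drop h) .left l c f) := by
  rintro s ⟨h1, h2, h3, h4⟩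
  refine ⟨1, ?_⟩
  simp only [Function.iterate_one, Board.tick, h1, h2]
  exact ⟨rfl, rfl, h3, h4⟩

variable {X : ℤ} {r : ℕ} {v : Var m} {l : List Hopper} {c : ℕ} {f : Var m → Bool}

/-- A traversal of a block, starting in its top row, whose outcome is found by iterating the local
tick. The outcome does not depend on the side to which the ball was moving. -/
theorem leads_block {Q : State → Prop} (a : ℤ) (n : ℕ) (out : Loc)
    (hv : (M.block X r).hasBit → RowVar m r v)
    (hout : ∀ d, (M.block X r).roll^[n] ⟨a, 0, d, f v, []⟩ = out)
    (hQ : ∀ s, M.Place X r v l c f out s → Q s) :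
    M.Leads (fun s => ∃ d, M.At (site X r a 0) d l c f s) Q := by
  rintro s ⟨d, hs⟩
  have h := leads_roll_iterate (c := c) (l := l) (f := f) hv n ⟨a, 0, d, f v, []⟩
  rw [hout d] at h
  refine (h.trans (.of_imp hQ)) s ?_
  unfold Machine.Place
  simpa using hs

/-- In a block without gear bits any variable may serve as the variable of the block row. -/
theorem plain_rowVar (h : (M.block X r).hasBit = false) :
    (M.block X r).hasBit → RowVar m r v := by
  simp [h]

theorem place_down {d : Side} {x : Bool} {t : List Hopper} (s : State)
    (h : M.Place X r v l c f ⟨2, 4, d, x, t⟩ s) :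
    M.Enter X (r + 1) (l ++ t) c (Function.update f v x) s := by
  exact ⟨d, h⟩

theorem place_left {d : Side} {x : Bool} {t : List Hopper} (s : State)
    (h : M.Place X r v l c f ⟨0, 4, d, x, t⟩ s) :
    M.Corner X (r + 1) (l ++ t) c (Function.update f v x) s := by
  exact ⟨d, h⟩

theorem place_right {d : Side} {x : Bool} {t : List Hopper} (s : State)
    (h : M.Place X r v l c f ⟨4, 4, d, x, t⟩ s) :
    M.Corner (X + 1) (r + 1) (l ++ t) c (Function.update f v x) s := by
  refine ⟨d, ?_⟩
  have e : site (X + 1) (r + 1) 0 0 = site X r 4 4 := by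
    simp only [site]; ext <;> simp only <;> omega
  rw [e]
  exact h

theorem enter_line
    (h : M.block X r = .pass ∨ M.block X r = .merge ∨ M.block X r = .cross) :
    M.Leads (M.Enter X r l c f) (M.Enter X (r + 1) l c f) := by
  have e : Function.update f .pFirst (f .pFirst) = f := Function.update_eq_self _ _
  rcases h with h | h | h
  · refine leads_block (v := .pFirst) 2 4 ⟨2, 4, .left, f .pFirst, []⟩
      (plain_rowVar (by rw [h]; rfl))
      (fun d => by rw [h]; rfl) (fun s hs => ?_)
    simpa [e] using place_down s hs
  · refine leads_block (v := .pFirst) 2 4 ⟨2, 4, .left, f .pFirst, []⟩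
      (plain_rowVar (by rw [h]; rfl))
      (fun d => by rw [h]; rfl) (fun s hs => ?_)
    simpa [e] using place_down s hs
  · refine leads_block (v := .pFirst) 2 4 ⟨2, 4, .right, f .pFirst, []⟩
      (plain_rowVar (by rw [h]; rfl))
      (fun d => by rw [h]; rfl) (fun s hs => ?_)
    simpa [e] using place_down s hs

theorem enter_diagonal (h : M.block X r = .diagonal) :
    M.Leads (M.Enter X r l c f) (M.Corner (X + 1) (r + 1) l c f) := by
  have e : Function.update f .pFirst (f .pFirst) = f := Function.update_eq_self _ _
  refine leads_block (v := .pFirst) 2 4 ⟨4, 4, .right, f .pFirst, []⟩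
      (plain_rowVar (by rw [h]; rfl))
    (fun d => by rw [h]; rfl) (fun s hs => ?_)
  simpa [e] using place_right s hs

theorem corner_diagonal (h : M.block X r = .diagonal ∨ M.block X r = .cross) :
    M.Leads (M.Corner X r l c f) (M.Corner (X + 1) (r + 1) l c f) := by
  have e : Function.update f .pFirst (f .pFirst) = f := Function.update_eq_self _ _
  refine leads_block (v := .pFirst) 0 4 ⟨4, 4, .right, f .pFirst, []⟩
    (plain_rowVar (by rcases h with h | h <;> rw [h] <;> rfl))
    (fun d => by rcases h with h | h <;> rw [h] <;> rfl) (fun s hs => ?_)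
  simpa [e] using place_right s hs

theorem corner_merge (h : M.block X r = .merge) :
    M.Leads (M.Corner X r l c f) (M.Enter X (r + 1) l c f) := by
  have e : Function.update f .pFirst (f .pFirst) = f := Function.update_eq_self _ _
  refine leads_block (v := .pFirst) 0 4 ⟨2, 4, .left, f .pFirst, []⟩
      (plain_rowVar (by rw [h]; rfl))
    (fun d => by rw [h]; rfl) (fun s hs => ?_)
  simpa [e] using place_down s hs

theorem corner_net (h : M.block X r = .net) :
    M.Leads (M.Corner X r l c f) (M.Stuck l c f) := by
  refine .of_imp fun s ⟨d, hs⟩ => ⟨_, d, ?_, hs⟩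
  exact (piece_site M X r 0 0).trans (by rw [h]; rfl)

theorem enter_fire (h : M.block X r = .fire) :
    M.Leads (M.Enter X r l c f) (M.Stuck (l ++ [.query]) c f) := by
  have e : Function.update f .pFirst (f .pFirst) = f := Function.update_eq_self _ _
  rintro s ⟨d, hs⟩
  cases d
  · refine (leads_roll_iterate (v := .pFirst) (c := c) (l := l) (f := f)
      (plain_rowVar (by rw [h]; rfl)) 1
      ⟨2, 0, .left, f .pFirst, []⟩).trans (.of_imp fun s hs => ?_) s
      (by simpa [e, Machine.Place] using hs)
    rw [h] at hs
    refine ⟨_, .left, (piece_site M X r 1 1).trans (by rw [h]; rfl), ?_⟩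
    have hs' : M.At (site X r 1 1) .left (l ++ [.query]) c
      (Function.update f .pFirst (f .pFirst)) s := hs
    rw [e] at hs'
    exact hs'
  · refine (leads_roll_iterate (v := .pFirst) (c := c) (l := l) (f := f)
      (plain_rowVar (by rw [h]; rfl)) 1
      ⟨2, 0, .right, f .pFirst, []⟩).trans (.of_imp fun s hs => ?_) s
      (by simpa [e, Machine.Place] using hs)
    rw [h] at hs
    refine ⟨_, .right, (piece_site M X r 3 1).trans (by rw [h]; rfl), ?_⟩
    have hs' : M.At (site X r 3 1) .right (l ++ [.query]) c
      (Function.update f .pFirst (f .pFirst)) s := hs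
    rw [e] at hs'
    exact hs'

theorem enter_ignore (h : M.block X r = .ignore) (hv : RowVar m r v) :
    M.Leads (M.Enter X r l c f) (M.Enter X (r + 1) l c f) := by
  have e : Function.update f v (f v) = f := Function.update_eq_self _ _
  refine leads_block (v := v) 2 4 ⟨2, 4, .left, f v, []⟩ (fun _ => hv)
    (fun d => by rw [h]; cases f v <;> rfl) (fun s hs => ?_)
  simpa [e] using place_down s hs

theorem enter_write {b : Bool} (h : M.block X r = .write b) (hv : RowVar m r v) :
    M.Leads (M.Enter X r l c f) (M.Enter X (r + 1) l c (Function.update f v b)) := by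
  refine leads_block (v := v) 2 4 ⟨2, 4, .left, b, []⟩ (fun _ => hv)
    (fun d => by rw [h]; cases f v <;> cases b <;> rfl) (fun s hs => ?_)
  simpa using place_down s hs

theorem enter_read_zero (h : M.block X r = .readBranch ∨ M.block X r = .writeBranch)
    (hv : RowVar m r v) (hf : f v = false) :
    M.Leads (M.Enter X r l c f) (M.Enter X (r + 1) l c f) := by
  have e : Function.update f v false = f := by rw [← hf]; exact Function.update_eq_self _ _
  refine leads_block (v := v) 2 4 ⟨2, 4, .right, false, []⟩ (fun _ => hv)
    (fun d => by rw [hf]; rcases h with h | h <;> rw [h] <;> rfl) (fun s hs => ?_)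
  simpa [e] using place_down s hs

theorem enter_readBranch (h : M.block X r = .readBranch) (hv : RowVar m r v) (hf : f v = true) :
    M.Leads (M.Enter X r l c f) (M.Corner (X + 1) (r + 1) l c f) := by
  have e : Function.update f v true = f := by rw [← hf]; exact Function.update_eq_self _ _
  refine leads_block (v := v) 2 4 ⟨4, 4, .right, true, []⟩ (fun _ => hv)
    (fun d => by rw [hf, h]; rfl) (fun s hs => ?_)
  simpa [e] using place_right s hs

theorem enter_writeBranch (h : M.block X r = .writeBranch) (hv : RowVar m r v) (hf : f v = true) :
    M.Leads (M.Enter X r l c f) (M.Corner (X + 1) (r + 1) l c (Function.update f v false)) := by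
  refine leads_block (v := v) 2 4 ⟨4, 4, .right, false, []⟩ (fun _ => hv)
    (fun d => by rw [hf, h]; rfl) (fun s hs => ?_)
  simpa using place_right s hs

theorem enter_treeRead_zero (h : M.block X r = .treeRead) (hv : RowVar m r v) (hf : f v = false) :
    M.Leads (M.Enter X r l c f) (M.Corner (X + 1) (r + 1) l c (Function.update f v true)) := by
  refine leads_block (v := v) 2 4 ⟨4, 4, .right, true, []⟩ (fun _ => hv)
    (fun d => by rw [hf, h]; rfl) (fun s hs => ?_)
  simpa using place_right s hs

theorem enter_treeRead_one (h : M.block X r = .treeRead) (hv : RowVar m r v) (hf : f v = true) :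
    M.Leads (M.Enter X r l c f) (M.Enter X (r + 1) l c (Function.update f v false)) := by
  refine leads_block (v := v) 2 4 ⟨2, 4, .right, false, []⟩ (fun _ => hv)
    (fun d => by rw [hf, h]; rfl) (fun s hs => ?_)
  simpa using place_down s hs

/-- The hopper that is triggered when `b` has been read on the tape. -/
def symbolHopper (b : Bool) : Hopper := if b then .one else .zero

theorem enter_query (h : M.block X r = .query) (hv : RowVar m r v)
    (h0 : M.block X (r + 1) = .net) (h1 : M.block (X + 1) (r + 1) = .net) :
    M.Leads (M.Enter X r l c f) (M.Stuck (l ++ [symbolHopper (f v)]) c f) := by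
  have e : Function.update f v (f v) = f := Function.update_eq_self _ _
  cases hf : f v
  · rw [hf] at e
    refine Machine.Leads.trans ?_ (corner_net h0)
    refine leads_block (v := v) 2 4 ⟨0, 4, .left, false, [.zero]⟩ (fun _ => hv)
      (fun d => by rw [hf, h]; rfl) (fun s hs => ?_)
    simpa [e, symbolHopper] using place_left s hs
  · rw [hf] at e
    refine Machine.Leads.trans ?_ (corner_net h1)
    refine leads_block (v := v) 2 4 ⟨4, 4, .right, true, [.one]⟩ (fun _ => hv)
      (fun d => by rw [hf, h]; rfl) (fun s hs => ?_)
    simpa [e, symbolHopper] using place_right s hs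

end

section
variable {m : ℕ} {M : Machine m} {l : List Hopper} {n : ℕ} {f : Var m → Bool}

/-! ### Routes of the balls -/

theorem enter_descend {X : ℤ} {r s : ℕ} (hrs : r ≤ s)
    (h : ∀ t, r ≤ t → t < s →
      (M.block X t = .pass ∨ M.block X t = .merge ∨ M.block X t = .cross) ∨
        (M.block X t = .ignore ∧ ∃ v, RowVar m t v)) :
    M.Leads (M.Enter X r l n f) (M.Enter X s l n f) := by
  induction s, hrs using Nat.le_induction with
  | base => exact .refl
  | succ s hs ih =>
    refine (ih fun t h1 h2 => h t h1 (by omega)).trans ?_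
    rcases h s hs (by omega) with h | ⟨h, v, hv⟩
    · exact enter_line h
    · exact enter_ignore h hv

theorem block_bus {X : ℤ} {r : ℕ} (h0 : 0 ≤ X) (h4 : X ≤ 4) (hr : r < tapeRow m) :
    M.block X r = .pass ∨ M.block X r = .merge ∨ M.block X r = .cross := by
  unfold Machine.block Machine.routerBlock
  rw [if_neg (by omega), if_pos hr]
  simp only
  rw [if_pos ⟨h0, h4⟩]
  split
  · simp
  · rw [if_neg (by omega)]
    split_ifs <;> simp

/-- The variable `p` of the 3-cell number `k`. -/
def Var.p {m : ℕ} : ℕ → Var m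
  | 0 => .pFirst
  | k + 1 => .h k

theorem rowVar_p (k : ℕ) : RowVar m (tapeRow m + 10 * k + 8) (.p k) := by
  cases k with
  | zero => exact .pFirst
  | succ k => exact .p k

/-- A 3-cell with `h = 0` keeps the ball on the bus and changes nothing. -/
theorem enter_cell_zero {X : ℤ} (h0 : 0 ≤ X) (h4 : X ≤ 4) {k : ℕ} (hf : f (.h k) = false) :
    M.Leads (M.Enter X (tapeRow m + 10 * k) l n f)
      (M.Enter X (tapeRow m + 10 * (k + 1)) l n f) := by
  have h1 : M.block X (tapeRow m + 10 * k) = .readBranch ∨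
      M.block X (tapeRow m + 10 * k) = .writeBranch := by
    have := block_cell M k 0 (by omega) X
    rw [Nat.add_zero] at this
    rw [this, cellBlock_bus h0 h4, if_pos rfl]
    split_ifs <;> simp
  refine (enter_read_zero h1 (.h k) hf).trans (enter_descend (by omega) fun t ht ht' => ?_)
  obtain ⟨j, rfl⟩ : ∃ j, t = tapeRow m + 10 * k + j := ⟨t - (tapeRow m + 10 * k), by omega⟩
  rw [block_cell M k j (by omega), cellBlock_bus h0 h4, if_neg (by omega)]
  split_ifs with h2 h3
  · simp
  · obtain ⟨rfl, -⟩ := h3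
    exact .inr ⟨rfl, _, rowVar_p k⟩
  · simp

theorem enter_bus {X : ℤ} (h0 : 0 ≤ X) (h4 : X ≤ 4) {k : ℕ} (hf : ∀ i < k, f (.h i) = false) :
    M.Leads (M.Enter X (tapeRow m) l n f) (M.Enter X (tapeRow m + 10 * k) l n f) := by
  induction k with
  | zero => exact .refl
  | succ k ih =>
    exact (ih fun i hi => hf i (by omega)).trans (enter_cell_zero h0 h4 (hf k (by omega)))

theorem corner_descend {X : ℤ} {r : ℕ} (t : ℕ)
    (h : ∀ i < t, M.block (X + i) (r + i) = .diagonal ∨ M.block (X + i) (r + i) = .cross) :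
    M.Leads (M.Corner X r l n f) (M.Corner (X + t) (r + t) l n f) := by
  induction t with
  | zero => simpa using Machine.Leads.refl
  | succ t ih =>
    refine (ih fun i hi => h i (by omega)).trans ?_
    have := corner_diagonal (l := l) (c := n) (f := f) (h t (by omega))
    rw [add_assoc, add_assoc] at this
    exact_mod_cast this

/-- A ball that left the bus line `X` at a row of `h` crosses the bus lines to the right and joins
the line `X + 5` of the 3-cell. -/
theorem corner_into_cell {X : ℤ} (h0 : 0 ≤ X) (h4 : X ≤ 4) (k : ℕ) :
    M.Leads (M.Corner (X + 1) (tapeRow m + 10 * k + 1) l n f)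
      (M.Enter (X + 5) (tapeRow m + 10 * k + 6) l n f) := by
  have h1 : ∀ i < 4, M.block (X + 1 + (i : ℕ)) (tapeRow m + 10 * k + 1 + i) = .diagonal ∨
      M.block (X + 1 + (i : ℕ)) (tapeRow m + 10 * k + 1 + i) = .cross := by
    intro i hi
    rw [add_assoc (tapeRow m + 10 * k), block_cell M k (1 + i) (by omega)]
    by_cases h : X + 1 + (i : ℕ) ≤ 4
    · rw [cellBlock_bus (by omega) h, if_neg (by omega), if_pos (by omega)]
      simp
    · rw [cellBlock_inside (by omega) (by omega), if_neg (by omega), if_neg (by omega),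
        if_pos (by omega), if_pos (by omega)]
      simp
  have h2 : M.block (X + 5) (tapeRow m + 10 * k + 5) = .merge := by
    rw [block_cell M k 5 (by omega), cellBlock_inside (by omega) (by omega), if_neg (by omega),
      if_neg (by omega), if_neg (by omega), if_pos rfl, if_pos (by omega)]
  have h3 := corner_descend (l := l) (n := n) (f := f) 4 h1
  have e : X + 1 + (4 : ℕ) = X + 5 := by push_cast; ring
  rw [e] at h3
  exact h3.trans (corner_merge h2)

/-! ### The query -/

/-- The values of the variables that represent a configuration. -/
def Config.bits (c : Config m) : Var m → Bool
  | .Q i => decide (i = c.state)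
  | .h k => decide (k = c.head)
  | .S k => c.tape k
  | .pFirst => false

/-- The Q-ball finds the scanned cell, releases the ball of the symbol in it, and changes nothing.
-/
theorem query_phase (c : Config m) :
    M.Leads (M.Idle [.query] n c.bits) (M.Stuck [symbolHopper (c.tape c.head)] n c.bits) := by
  have h0 : M.Leads (M.Idle [.query] n c.bits) (M.Enter 4 0 [] n c.bits) :=
    idle_tick.trans (.of_imp fun s hs => ⟨.left, hs⟩)
  have h1 : M.Leads (M.Enter 4 0 [] n c.bits) (M.Enter 4 (tapeRow m) [] n c.bits) :=
    enter_descend (by omega) fun t _ ht => .inl (block_bus (by omega) (by omega) ht)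
  have h2 : M.Leads (M.Enter 4 (tapeRow m) [] n c.bits)
      (M.Enter 4 (tapeRow m + 10 * c.head) [] n c.bits) :=
    enter_bus (by omega) (by omega) fun i hi => by simp [Config.bits]; omega
  have h3 : M.block 4 (tapeRow m + 10 * c.head) = .readBranch := by
    have := block_cell M c.head 0 (by omega) 4
    rw [Nat.add_zero] at this
    rw [this, cellBlock_bus (by omega) (by omega), if_pos rfl, if_pos rfl]
  have h4 := enter_readBranch (l := []) (c := n) (f := c.bits) h3 (.h c.head)
    (by simp [Config.bits])
  have h5 : M.block 9 (tapeRow m + 10 * c.head + 6) = .query := by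
    rw [block_cell M c.head 6 (by omega)]
    rfl
  have h6 : M.block 9 (tapeRow m + 10 * c.head + 6 + 1) = .net := by
    rw [add_assoc, block_cell M c.head (6 + 1) (by omega)]
    rfl
  have h7 : M.block (9 + 1) (tapeRow m + 10 * c.head + 6 + 1) = .net := by
    rw [add_assoc, block_cell M c.head (6 + 1) (by omega)]
    rfl
  exact h0.trans (h1.trans (h2.trans (h4.trans ((corner_into_cell (by omega) (by omega) _).trans
    (enter_query h5 (.S c.head) h6 h7)))))

/-! ### The state transition -/

/-- The block column in which the tree below the `b`-hopper starts. -/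
def treeColumn (m : ℕ) (b : Bool) : ℤ := (if b then -2 else -3) * (m + 1)

/-- In the tree, the ball moves to the next column after each state variable that shows `0`, and
sets that variable to `1`. -/
theorem enter_tree {b : Bool} {i : ℕ} (hi : i ≤ m)
    (hf : ∀ j : Fin (m + 1), j.val < i → f (.Q j) = false) :
    M.Leads (M.Enter (treeColumn m b) 0 l n f) (M.Enter (treeColumn m b + i) (2 * i) l n
      (fun v => match v with
        | .Q j => if j.val < i then true else f (.Q j)
        | v => f v)) := by
  induction i with
  | zero =>
    convert Machine.Leads.refl using 2
    · simp
    · funext v; cases v <;> simp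
  | succ i ih =>
    refine (ih (by omega) fun j hj => hf j (by omega)).trans ?_
    have h1 : M.block (treeColumn m b + i) (2 * i) = .treeRead := by
      unfold treeColumn
      rw [block_tree M b i _ (by omega) (by omega)]
      unfold Machine.treeBlock
      rw [if_pos (by omega), if_pos (by omega), if_neg (by omega), if_pos (by omega),
        if_neg (by omega)]
    have h2 : M.block (treeColumn m b + (i + 1 : ℕ)) (2 * i + 1) = .merge := by
      unfold treeColumn
      rw [block_tree M b (i + 1) _ (by omega) (by omega)]
      unfold Machine.treeBlock
      rw [if_pos (by omega), if_neg (by omega), if_neg (by omega), if_pos (by omega)]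
    rw [Nat.cast_add_one, ← add_assoc] at h2 ⊢
    refine (enter_treeRead_zero h1 (.Q ⟨i, by omega⟩) ?_).trans ?_
    · simp only [lt_irrefl, if_false]
      exact hf _ (by simp)
    · have h3 := corner_merge (l := l) (c := n) (f := fun v => match v with
        | .Q j => if j.val < i + 1 then true else f (.Q j)
        | v => f v) h2
      convert h3 using 2
      swap
      · rfl
      funext v
      cases v with
      | Q j =>
        by_cases hj : j = ⟨i, by omega⟩
        · subst hj; simp
        · have : j.val ≠ i := fun h => hj (Fin.ext h)
          rw [Function.update_of_ne (by simpa using hj)]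
          simp only
          split_ifs <;> first | rfl | omega
      | _ => rw [Function.update_of_ne (by simp)]

/-- The rows `Q' m, …, Q' (m + 1 - u)` write the new state, whatever the state variables showed. -/
theorem enter_write_rows {b : Bool} {i : ℕ} (hi : i < m) (u : ℕ) (hu : u ≤ m + 1) :
    M.Leads (M.Enter (treeColumn m b + i) (2 * (m + 1)) l n f)
      (M.Enter (treeColumn m b + i) (2 * (m + 1) + u) l n
      (fun v => match v with
        | .Q j => if m < j.val + u then decide (j = (M.δ ⟨i, hi⟩ b).1) else f (.Q j)
        | v => f v)) := by
  induction u with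
  | zero =>
    convert Machine.Leads.refl using 2
    · rfl
    funext v
    cases v with
    | Q j => simp only; rw [if_neg (by omega)]
    | _ => rfl
  | succ u ih =>
    refine (ih (by omega)).trans ?_
    have h1 : M.block (treeColumn m b + i) (2 * (m + 1) + u) =
        .write (decide ((⟨m - u, by omega⟩ : Fin (m + 1)) = (M.δ ⟨i, hi⟩ b).1)) := by
      unfold treeColumn
      rw [block_tree M b i _ (by omega) (by omega)]
      unfold Machine.treeBlock Machine.action
      rw [if_neg (by omega), dif_pos hi]
      simp only
      congr 1
      rw [decide_eq_decide, Fin.ext_iff]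
      simp only
      omega
    have hv : RowVar m (2 * (m + 1) + u) (.Q ⟨m - u, by omega⟩) := by
      have := RowVar.Q' (m := m) ⟨m - u, by omega⟩
      convert this using 1
      simp only; omega
    convert enter_write h1 hv using 2
    · rfl
    funext v
    cases v with
    | Q j =>
      by_cases hj : j = ⟨m - u, by omega⟩
      · rw [hj, Function.update_self]
        simp only
        rw [if_pos (by omega)]
      · have : j.val ≠ m - u := fun h => hj (Fin.ext h)
        rw [Function.update_of_ne (by simpa using hj)]
        simp only
        split_ifs <;> first | rfl | omega
    | _ => rw [Function.update_of_ne (by simp)]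

theorem drop_symbol (b : Bool) : M.board.drop (symbolHopper b) = entry (treeColumn m b) 0 := by
  cases b <;> simp [symbolHopper, Machine.board, site, treeColumn]

/-- The State Transition Module replaces the state `q` by the new state, and the ball leaves it in
column `q` of its tree. -/
theorem enter_stm {b : Bool} {q : Fin (m + 1)} (hq : q.val < m)
    (hf : ∀ i, f (.Q i) = decide (i = q)) :
    M.Leads (M.Idle [symbolHopper b] n f) (M.Enter (treeColumn m b + q.val) (3 * (m + 1)) [] n
      (fun v => match v with
        | .Q j => decide (j = (M.δ ⟨q, hq⟩ b).1)
        | v => f v)) := by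
  have h0 : M.Leads (M.Idle [symbolHopper b] n f) (M.Enter (treeColumn m b) 0 [] n f) :=
    idle_tick.trans (.of_imp fun s hs => ⟨.left, by rwa [drop_symbol] at hs⟩)
  have h1 := enter_tree (M := M) (l := []) (n := n) (f := f) (b := b) (i := q) (by omega)
    fun j hj => by rw [hf]; simp; omega
  have h2 : M.block (treeColumn m b + q.val) (2 * q.val) = .treeRead := by
    unfold treeColumn
    rw [block_tree M b q _ (by omega) (by omega)]
    unfold Machine.treeBlock
    rw [if_pos (by omega), if_pos (by omega), if_neg (by omega), if_pos (by omega),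
      if_neg (by omega)]
  have h3 := fun g hg => enter_treeRead_one (l := []) (c := n) (f := g) h2 (.Q q) hg
  have h4 : ∀ g, M.Leads (M.Enter (treeColumn m b + q.val) (2 * q.val + 1) [] n g)
      (M.Enter (treeColumn m b + q.val) (2 * (m + 1)) [] n g) := by
    intro g
    refine enter_descend (by omega) fun t h h' => ?_
    unfold treeColumn
    rw [block_tree M b q _ (by omega) (by omega)]
    unfold Machine.treeBlock
    rw [if_pos h']
    by_cases ht : t % 2 = 0
    · rw [if_pos ht, if_pos (by omega)]
      refine .inr ⟨rfl, .Q ⟨t / 2, by omega⟩, ?_⟩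
      convert RowVar.Q (m := m) ⟨t / 2, by omega⟩ using 1
      simp only; omega
    · rw [if_neg ht, if_pos (by omega)]
      simp
  -- The state variables before `q` now show `1` and that of `q` shows `0`; all are overwritten.
  refine h0.trans (h1.trans ((h3 _ ?_).trans ((h4 _).trans ?_)))
  · simp [hf]
  · have h5 := fun g =>
      enter_write_rows (M := M) (l := []) (n := n) (f := g) (b := b) hq (m + 1) le_rfl
    have e : 2 * (m + 1) + (m + 1) = 3 * (m + 1) := by ring
    rw [e] at h5
    convert h5 _ using 2
    funext v
    cases v with
    | Q j => simp only; rw [if_pos (by omega)]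
    | _ => simp only; rw [Function.update_of_ne (by simp)]

/-- The router takes the ball to the bus line of the action. -/
theorem enter_router {b : Bool} {q : ℕ} (hq : q < m) :
    M.Leads (M.Enter (treeColumn m b + q) (3 * (m + 1)) l n f)
      (M.Enter (busLine (M.δ ⟨q, hq⟩ b).2.2 (M.δ ⟨q, hq⟩ b).2.1) (tapeRow m) l n f) := by
  set B := busLine (M.δ ⟨q, hq⟩ b).2.2 (M.δ ⟨q, hq⟩ b).2.1 with hB
  have hB0 : 0 ≤ B ∧ B ≤ 3 := by
    rw [hB]
    cases (M.δ ⟨q, hq⟩ b).2.2 <;> cases (M.δ ⟨q, hq⟩ b).2.1 <;> decide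
  have hX : -3 * ((m : ℤ) + 1) ≤ treeColumn m b + q ∧ treeColumn m b + q < -(m + 1) := by
    unfold treeColumn
    cases b
    · simp only [Bool.false_eq_true, if_false]; omega
    · simp only [if_true]; omega
  have hout : M.outgoing (treeColumn m b + q) = some (M.δ ⟨q, hq⟩ b) := by
    unfold Machine.outgoing Machine.action treeColumn
    cases b
    · simp only [Bool.false_eq_true, if_false]
      rw [if_pos (by omega)]
      have e : (-3 * ((m : ℤ) + 1) + q + 3 * (m + 1)).toNat = q := by omega
      simp only [e]
      rw [dif_pos hq]
    · simp only [if_true]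
      rw [if_neg (by omega), if_pos (by omega)]
      have e : (-2 * ((m : ℤ) + 1) + q + 2 * (m + 1)).toNat = q := by omega
      simp only [e]
      rw [dif_pos hq]
  set X := treeColumn m b + q with hXdef
  -- All blocks `(X + t, 3 (m + 1) + t)` lie on the diagonal that comes from column `X`.
  have hblock : ∀ t : ℕ, X + t ≤ B → M.block (X + t) (3 * (m + 1) + t) =
      if X + t < 0 then .diagonal else if X + t < B then .cross else .merge := by
    intro t ht
    unfold Machine.block Machine.routerBlock
    rw [if_neg (by omega), if_pos (by unfold tapeRow; omega)]
    have e : X + t + 3 * (m + 1) - ((3 * (m + 1) + t : ℕ) : ℤ) = X := by push_cast; ring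
    rw [e, hout]
    simp only
    rw [← hB]
    split_ifs <;> first | rfl | omega
  obtain ⟨T, hT⟩ : ∃ T : ℕ, X + 1 + T = B := ⟨(B - (X + 1)).toNat, by omega⟩
  have h1 : M.block X (3 * (m + 1)) = .diagonal := by
    have := hblock 0 (by omega)
    simp only [Nat.cast_zero, add_zero] at this
    rw [this, if_pos (by omega)]
  have h2 : M.Leads (M.Corner (X + 1) (3 * (m + 1) + 1) l n f)
      (M.Corner (X + 1 + T) (3 * (m + 1) + 1 + T) l n f) := by
    refine corner_descend T fun i hi => ?_
    have := hblock (1 + i) (by omega)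
    rw [Nat.cast_add, Nat.cast_one, ← add_assoc, ← add_assoc] at this
    rw [this]
    split_ifs <;> first | exact .inl rfl | exact .inr rfl | omega
  have h3 : M.block B (3 * (m + 1) + 1 + T) = .merge := by
    have := hblock (1 + T) (by omega)
    rw [Nat.cast_add, Nat.cast_one, ← add_assoc, ← add_assoc, hT] at this
    rw [this, if_neg (by omega), if_neg (by omega)]
  rw [hT] at h2
  refine (enter_diagonal h1).trans (h2.trans ((corner_merge h3).trans (enter_descend ?_ ?_)))
  · unfold tapeRow; omega
  · intro t _ ht
    exact .inl (block_bus (by omega) (by omega) ht)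

/-! ### The action on the tape -/

theorem enter_head {X : ℤ} (h0 : 0 ≤ X) (h3 : X ≤ 3) {x : ℕ} (hf : ∀ i, f (.h i) = decide (i = x)) :
    M.Leads (M.Enter X (tapeRow m) l n f) (M.Enter (X + 5) (tapeRow m + 10 * x + 6) l n
      (Function.update f (.h x) false)) := by
  have h1 : M.block X (tapeRow m + 10 * x) = .writeBranch := by
    have := block_cell M x 0 (by omega) X
    rw [Nat.add_zero] at this
    rw [this, cellBlock_bus (by omega) (by omega), if_pos rfl, if_neg (by omega)]
  exact (enter_bus h0 (by omega) fun i hi => by rw [hf]; simp; omega).trans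
    ((enter_writeBranch h1 (.h x) (by rw [hf]; simp)).trans (corner_into_cell h0 (by omega) x))

/-- Inside the scanned 3-cell, the symbol is written to `S`, and `p` is set to `1` exactly if the
head moves to the left. -/
theorem enter_symbol (s : Side) (b : Bool) (x : ℕ) :
    M.Leads (M.Enter (busLine s b + 5) (tapeRow m + 10 * x + 6) l n f)
      (M.Enter (busLine s b + 5) (tapeRow m + 10 * x + 9) l n
        (Function.update (Function.update f (.S x) b) (.p x) (decide (s = .left)))) := by
  have h1 : M.block (busLine s b + 5) (tapeRow m + 10 * x + 6) = .write b := by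
    rw [block_cell M x 6 (by omega)]
    cases s <;> cases b <;> rfl
  have h2 : M.block (busLine s b + 5) (tapeRow m + 10 * x + 7) = .pass := by
    rw [block_cell M x 7 (by omega)]
    cases s <;> cases b <;> rfl
  have h3 : M.block (busLine s b + 5) (tapeRow m + 10 * x + 8) = .write (decide (s = .left)) := by
    rw [block_cell M x 8 (by omega)]
    cases s <;> cases b <;> rfl
  exact (enter_write h1 (.S x)).trans ((enter_line (.inl h2)).trans (enter_write h3 (rowVar_p x)))

theorem enter_move_left (b : Bool) (x : ℕ) :
    M.Leads (M.Enter (busLine .left b + 5) (tapeRow m + 10 * x + 9) l n f)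
      (M.Stuck (l ++ [.query]) n f) := by
  apply enter_fire
  rw [block_cell M x 9 (by omega)]
  cases b <;> rfl

theorem enter_move_right (b : Bool) (x : ℕ) :
    M.Leads (M.Enter (busLine .right b + 5) (tapeRow m + 10 * x + 9) l n f)
      (M.Stuck (l ++ [.query]) n (Function.update f (.h (x + 1)) true)) := by
  have h1 : M.block (busLine .right b + 5) (tapeRow m + 10 * x + 9) = .pass := by
    rw [block_cell M x 9 (by omega)]
    cases b <;> rfl
  have h2 : M.block (busLine .right b + 5) (tapeRow m + 10 * (x + 1)) = .write true := by
    have := block_cell M (x + 1) 0 (by omega) (busLine .right b + 5)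
    rw [Nat.add_zero] at this
    rw [this]
    cases b <;> rfl
  have h3 : M.block (busLine .right b + 5) (tapeRow m + 10 * (x + 1) + 1) = .fire := by
    rw [block_cell M (x + 1) 1 (by omega)]
    cases b <;> rfl
  exact (enter_line (.inl h1)).trans ((enter_write h2 (.h (x + 1))).trans (enter_fire h3))

/-- The `0`- or `1`-ball carries out one step of the machine. -/
theorem action_phase {c c' : Config m} (hc : M.step c = some c') :
    M.Leads (M.Idle [symbolHopper (c.tape c.head)] n c.bits) (M.Stuck [.query] n c'.bits) := by
  unfold Machine.step at hc
  split_ifs at hc with hq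
  simp only at hc
  have hB0 : ∀ s b, 0 ≤ busLine s b ∧ busLine s b ≤ 3 := by
    intro s b
    cases s <;> cases b <;> decide
  have h1 := enter_stm (M := M) (n := n) (f := c.bits) (b := c.tape c.head) hq fun i => rfl
  have h2 := fun g => enter_router (M := M) (l := []) (n := n) (f := g) (b := c.tape c.head) hq
  have h3 := fun g hg => enter_head (M := M) (l := []) (n := n) (f := g) (x := c.head)
    (hB0 (M.δ ⟨c.state, hq⟩ (c.tape c.head)).2.2 (M.δ ⟨c.state, hq⟩ (c.tape c.head)).2.1).1
    (hB0 (M.δ ⟨c.state, hq⟩ (c.tape c.head)).2.2 (M.δ ⟨c.state, hq⟩ (c.tape c.head)).2.1).2 hg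
  refine h1.trans ((h2 _).trans ((h3 _ fun i => rfl).trans ((enter_symbol _ _ _).trans ?_)))
  generalize M.δ ⟨c.state, hq⟩ (c.tape c.head) = a at hc
  obtain ⟨q, b, s⟩ := a
  obtain ⟨q0, x, τ⟩ := c
  simp only at hc ⊢
  cases s with
  | left =>
    cases x with
    | zero => simp at hc
    | succ x =>
      simp only [Option.some.injEq] at hc
      subst hc
      convert enter_move_left b (x + 1) using 2
      · rfl
      funext v
      cases v with
      | Q i => simp [Config.bits, Var.p]
      | h k =>
        by_cases h1 : k = x
        · simp [Config.bits, Function.update_apply, Var.p, h1]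
        · by_cases h2 : k = x + 1 <;> simp [Config.bits, Var.p, h1, h2]
      | S k => simp [Config.bits, Function.update_apply, Var.p]
      | pFirst => simp [Config.bits, Var.p]
  | right =>
    simp only [Option.some.injEq] at hc
    subst hc
    convert enter_move_right b x using 2
    · rfl
    funext v
    cases x with
    | zero =>
      cases v with
      | Q i => simp [Config.bits, Var.p]
      | h k =>
        by_cases h1 : k = 1
        · simp [Config.bits, Function.update_apply, Var.p, h1]
        · by_cases h2 : k = 0 <;> simp [Config.bits, Var.p, h1, h2]
      | S k => simp [Config.bits, Function.update_apply, Var.p]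
      | pFirst => simp [Config.bits, Var.p]
    | succ x =>
      cases v with
      | Q i => simp [Config.bits, Var.p]
      | h k =>
        by_cases h1 : k = x + 1 + 1
        · simp [Config.bits, Function.update_apply, Var.p, h1]
        · by_cases h2 : k = x + 1
          · simp [Config.bits, Var.p, h2]
          · by_cases h3 : k = x <;> simp [Config.bits, Function.update_apply, Var.p, h1, h2, h3]
      | S k => simp [Config.bits, Function.update_apply, Var.p]
      | pFirst => simp [Config.bits, Var.p]

/-! ### The simulation -/

theorem caught_tick (B : Board) (s : State) : s.caught ≤ (B.tick s).caught := by
  unfold Board.tick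
  split
  · split <;> exact le_rfl
  · split <;> simp

theorem simulation_succ (w : List Bool) (t : ℕ) :
    M.simulation w (t + 1) = M.board.tick (M.simulation w t) :=
  Function.iterate_succ_apply' _ _ _

theorem simulation_caught_mono (w : List Bool) :
    Monotone fun t => (M.simulation w t).caught :=
  monotone_nat_of_le_succ fun t => by rw [simulation_succ]; exact caught_tick _ _

theorem leads_simulation {P Q : State → Prop} (h : M.Leads P Q) {w : List Bool} {t : ℕ}
    (ht : P (M.simulation w t)) : ∃ t', Q (M.simulation w t') := by
  obtain ⟨k, hk⟩ := h _ ht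
  refine ⟨k + t, ?_⟩
  unfold Machine.simulation Board.run at hk ⊢
  rwa [Function.iterate_add_apply]

theorem encodes_setup (M : Machine m) (w : List Bool) :
    M.Encodes (Config.initial m w).bits (M.setup w) := by
  intro v p hp
  have h1 : (∃ v', p ∈ M.bitsOf v' ∧ InitiallyOne w v') ↔ InitiallyOne w v :=
    ⟨fun ⟨_, h1, h2⟩ => bitsOf_unique M h1 hp ▸ h2, fun h1 => ⟨v, hp, h1⟩⟩
  classical
  unfold Machine.setup
  rw [Bool.eq_iff_iff, decide_eq_true_iff, h1]
  cases v with
  | Q i =>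
    refine Iff.trans ⟨fun h1 => ?_, fun h1 => ?_⟩ decide_eq_true_iff.symm
    · cases h1; rfl
    · obtain rfl : i = 0 := h1
      exact .Q
  | h k =>
    refine Iff.trans ⟨fun h1 => ?_, fun h1 => ?_⟩ decide_eq_true_iff.symm
    · cases h1; rfl
    · obtain rfl : k = 0 := h1
      exact .h
  | S k =>
    refine ⟨fun h1 => ?_, fun h1 => .S k h1⟩
    cases h1
    assumption
  | pFirst => exact ⟨fun h1 => (nomatch h1), fun h1 => absurd h1 Bool.false_ne_true⟩

/-- After `2 n` intercepted balls, and not earlier, the board represents the configuration after `n`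
steps and is about to release a Q-ball. -/
theorem simulation_after (w : List Bool) (n : ℕ) (c : Config m) (hc : M.after w n = some c) :
    ∃ t, M.Idle [.query] (2 * n) c.bits (M.simulation w t) ∧
      ∀ t' < t, (M.simulation w t').caught < 2 * n := by
  induction n generalizing c with
  | zero =>
    simp only [Machine.after, Option.some.injEq] at hc
    subst hc
    exact ⟨0, ⟨rfl, rfl, rfl, encodes_setup M w⟩, fun t' h => absurd h (by omega)⟩
  | succ n ih =>
    simp only [Machine.after, Option.bind_eq_some_iff] at hc
    obtain ⟨c0, h0, hc⟩ := hc
    obtain ⟨t, ht, -⟩ := ih c0 h0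
    obtain ⟨t1, h1⟩ := leads_simulation (query_phase c0) ht
    have h2 := stuck_tick h1
    rw [← simulation_succ] at h2
    obtain ⟨t2, h2⟩ := leads_simulation (action_phase hc) h2
    have h3 := stuck_tick h2
    rw [← simulation_succ] at h3
    refine ⟨t2 + 1, h3, fun t' ht' => ?_⟩
    obtain ⟨_, _, _, _, _, h4, _⟩ := h2
    have := simulation_caught_mono (M := M) w (show t' ≤ t2 by omega)
    simp only at this
    omega

theorem bitsOf_nonempty (M : Machine m) (v : Var m) : (M.bitsOf v).Nonempty := by
  have key : ∀ (X : ℤ) (r : ℕ), (M.block X r).picture 0 2 = some .gearBit → RowVar m r v →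
      (M.bitsOf v).Nonempty := by
    intro X r h hv
    refine ⟨entry X r, (piece_site M X r 2 0).trans h, ?_⟩
    have e := (site_div X r 2 0).2
    exact e.symm ▸ hv
  cases v with
  | Q i =>
    refine key (treeColumn m false + i.val) (2 * i) ?_ (.Q i)
    unfold treeColumn
    rw [block_tree M false i _ (by omega) (by omega)]
    unfold Machine.treeBlock
    rw [if_pos (by omega), if_pos (by omega), if_neg (by omega), if_pos (by omega)]
    split_ifs <;> rfl
  | h k =>
    refine key 4 (tapeRow m + 10 * k + 0) ?_ (.h k)
    rw [block_cell M k 0 (by omega)]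
    rfl
  | S k =>
    refine key 9 (tapeRow m + 10 * k + 6) ?_ (.S k)
    rw [block_cell M k 6 (by omega)]
    rfl
  | pFirst =>
    refine key 5 (tapeRow m + 10 * 0 + 8) ?_ .pFirst
    rw [block_cell M 0 8 (by omega)]
    rfl

end

end TuringTumble

open TuringTumble in
theorem theorem5p4 (m : ℕ) (M : Machine m) (w : List Bool) (n : ℕ) (c : Config m)
    (hc : M.after w n = some c) :
    ∃ t : ℕ, IsLeast {t : ℕ | (M.simulation w t).caught = 2 * n} t ∧
      (M.Shows (M.simulation w t).values (.Q c.state) true ∧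
        ∀ i : Fin (m + 1), i ≠ c.state → M.Shows (M.simulation w t).values (.Q i) false) ∧
      (M.Shows (M.simulation w t).values (.h c.head) true ∧
        ∀ k : ℕ, k ≠ c.head → M.Shows (M.simulation w t).values (.h k) false) ∧
      ∀ k : ℕ, M.Shows (M.simulation w t).values (.S k) (c.tape k) := by
  obtain ⟨t, ⟨-, -, h1, h2⟩, h3⟩ := simulation_after w n c hc
  have key : ∀ v b, c.bits v = b → M.Shows (M.simulation w t).values v b :=
    fun v b hb => ⟨bitsOf_nonempty M v, fun p hp => (h2 v p hp).trans hb⟩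
  refine ⟨t, ⟨h1, fun t' ht' => ?_⟩, ⟨key _ _ ?_, fun i hi => key _ _ ?_⟩,
    ⟨key _ _ ?_, fun k hk => key _ _ ?_⟩, fun k => key _ _ rfl⟩
  · by_contra h
    exact (h3 t' (not_le.1 h)).ne ht'
  · simp [Config.bits]
  · simp [Config.bits, hi]
  · simp [Config.bits]
  · simp [Config.bits, hk]
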